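/- Let $n\ge 1$, $1\le p<\infty$, and write $|E|$ for the Lebesgue measure of $E\subset\mathbb{R}^n$. A set $K\subset\mathbb{R}^n$ that is star-shaped with respect to the origin is called a star body if its radial function $\rho_K(x)=\sup\{\lambda\ge 0:\lambda x\in K\}$ is finite, strictly positive and continuous on $\mathbb{R}^n\setminus\{0\}$; its gauge function is $\|x\|_K=\inf\{\lambda>0: x\in\lambda K\}$. For a star body $K$, a function $f\in L^p(\mathbb{R}^n)$ and $t>0$, the anisotropic modulus of smoothness is $$\omega_K(f,t)_p=\bigg(\frac{1}{t^n|K|}\int_{\|h\|_K<t}\|f(\cdot+h)-f\|_{L^p(\mathbb{R}^n)}^p\,dh\bigg)^{1/p}.$$ For a set $E$ of finite measure let $E^\star$ be the closed Euclidean ball centered at the origin with $|E^\star|=|E|$ (the empty set if $|E|=0$), and for a real-valued $f\in L^p(\mathbb{R}^n)$ let $$f^\star(x)=\int_0^\infty \mathbf{1}_{\{|f|\ge t\}^\star}(x)\,dt ,$$ which is finite for every $x\neq 0$. Then for every star body $K\subset\mathbb{R}^n$, every real-valued $f\in L^p(\mathbb{R}^n)$ and every $t>0$, $$\omega_{K^\star}(f^\star,t)_p\le\omega_K(f,t)_p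 .$$ -/

import Mathlib

open MeasureTheory

noncomputable section

namespace AnisotropicModulus

/-- Schwarz symmetral `E^⋆` of a set `E ⊂ ℝⁿ` of finite measure: the closed centered Euclidean
ball of radius `(|E| / |B^n|)^{1/n}`, i.e. the closed centered ball with `|E^⋆| = |E|`
(see `volume_schwarzSet`). The symmetral of a null set is the empty ball. -/
def schwarzSet {n : ℕ} (E : Set (EuclideanSpace ℝ (Fin n))) : Set (EuclideanSpace ℝ (Fin n)) :=
  {x | volume E ≠ 0 ∧ x ∈ Metric.closedBall (0 : EuclideanSpace ℝ (Fin n))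
    ((volume E / volume (Metric.closedBall (0 : EuclideanSpace ℝ (Fin n)) 1)).toReal
      ^ (1 / (n : ℝ)))}

theorem volume_schwarzSet {n : ℕ} (hn : 1 ≤ n) (E : Set (EuclideanSpace ℝ (Fin n)))
    (hE : volume E ≠ ⊤) : volume (schwarzSet E) = volume E := by
  by_cases h0 : volume E = 0
  · simp [schwarzSet, h0]
  · have hB0 : volume (Metric.closedBall (0 : EuclideanSpace ℝ (Fin n)) 1) ≠ 0 :=
      (Metric.measure_closedBall_pos volume _ one_pos).ne'
    have hBt : volume (Metric.closedBall (0 : EuclideanSpace ℝ (Fin n)) 1) ≠ ⊤ :=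
      measure_closedBall_lt_top.ne
    have hq : (0 : ℝ) ≤
        (volume E / volume (Metric.closedBall (0 : EuclideanSpace ℝ (Fin n)) 1)).toReal :=
      ENNReal.toReal_nonneg
    have hset : schwarzSet E = Metric.closedBall (0 : EuclideanSpace ℝ (Fin n))
        ((volume E / volume (Metric.closedBall (0 : EuclideanSpace ℝ (Fin n)) 1)).toReal
          ^ (1 / (n : ℝ))) := by
      ext x
      simp [schwarzSet, h0]
    rw [hset, Measure.addHaar_closedBall' volume _ (Real.rpow_nonneg hq _),
      finrank_euclideanSpace_fin, ← Real.rpow_natCast, ← Real.rpow_mul hq,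
      one_div_mul_cancel (by positivity), Real.rpow_one,
      ENNReal.ofReal_toReal (ENNReal.div_ne_top hE hB0), ENNReal.div_mul_cancel hB0 hBt]

/-- Schwarz symmetral (spherically symmetric rearrangement) of a function:
`f^⋆(x) = ∫_0^∞ 1_{{|f| ≥ t}^⋆}(x) dt`. -/
def schwarzFun {n : ℕ} (f : EuclideanSpace ℝ (Fin n) → ℝ) (x : EuclideanSpace ℝ (Fin n)) : ℝ :=
  ∫ t in Set.Ioi (0 : ℝ), (schwarzSet {y | t ≤ |f y|}).indicator (fun _ => (1 : ℝ)) x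

/-- Radial function `ρ_K(x) = sup {r ≥ 0 : r x ∈ K}`. -/
def radialFun {n : ℕ} (K : Set (EuclideanSpace ℝ (Fin n))) (x : EuclideanSpace ℝ (Fin n)) : ℝ :=
  sSup {r : ℝ | 0 ≤ r ∧ r • x ∈ K}

/-- Star body: a set star-shaped with respect to the origin whose radial function is (finite,)
strictly positive and continuous on `ℝⁿ \ {0}`. When the supremum defining `ρ_K(x)` is infinite,
`radialFun K x = 0`, so positivity also forces `ρ_K` to be finite. -/
structure IsStarBody {n : ℕ} (K : Set (EuclideanSpace ℝ (Fin n))) : Prop where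
  starConvex : StarConvex ℝ 0 K
  radial_pos : ∀ x, x ≠ 0 → 0 < radialFun K x
  radial_continuousOn : ContinuousOn (radialFun K) {0}ᶜ

/-- Anisotropic modulus of smoothness, for `1 ≤ p < ∞` and `t > 0`:
`ω_K(f,t)_p = ( (1 / (tⁿ |K|)) ∫_{‖h‖_K < t} ‖f(· + h) - f‖_{L^p}^p dh )^{1/p}`,
as an element of `[0, ∞]`. Mathlib's `gauge K h = inf {r > 0 : h ∈ r K}` is `‖h‖_K`. -/
def modulus {n : ℕ} (K : Set (EuclideanSpace ℝ (Fin n))) (f : EuclideanSpace ℝ (Fin n) → ℝ)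
    (t p : ℝ) : ENNReal :=
  ((ENNReal.ofReal (t ^ n) * volume K)⁻¹ *
    ∫⁻ h in {h | gauge K h < t},
      (eLpNorm (fun x => f (x + h) - f x) (ENNReal.ofReal p) volume) ^ p) ^ (1 / p)

end AnisotropicModulus

end

/-!
The functional `∫_{‖h‖_K < t} ‖f(· + h) - f‖_p^p dh` is a superposition of Riesz functionals of
level sets, so the theorem follows from Riesz's rearrangement inequality for three sets, which is
proved here from scratch.

*Reduction to level sets.* Replacing `f` by `|f|` does not increase the right-hand side and does
not change `f^⋆`. For `a, b ≥ 0` the quantity `(a - b)₊ ^ p` is the measure of the `(s, v)` such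
that `b < s` and `a` lies in an upper set `layer p (s, v)` (`volume_layer`), which is empty or a
half-line `[c, ∞)` with `c ≥ s`. Integrating over `x` and `h ∈ W` gives the measure of the pairs
with `h ∈ W`, `f x < s` and `f (h + x) ≥ c`. This is `|W| |{f ≥ c}|` minus the Riesz functional of
`W`, `{f ≥ s}` and `{f ≥ c}`, hence can only decrease when all three sets are replaced by centred
balls (`IsSymmDecreasingRearr.lintegral_abs_sub_le`).

*Riesz's inequality on the line.* For every `t ≤ min |A| |B|`, discarding the leftmost part of `A`
and the rightmost part of `B` of measure `t` gives the bound `(|A| - t) (|B| - t) + t |C|`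
(`sumTriple_le_add_mul`). For centred intervals, the best choice of `t` gives equality.

*Riesz's inequality in higher dimension.* By Fubini's theorem along parallel lines, Steiner
symmetrization does not decrease the Riesz functional (`sumTriple_le_steiner`). For a bounded set
`A` no larger than a ball, some direction makes the part of `A` outside the ball smaller by an
amount that depends only on the size of that part and on a bound for `A`
(`exists_volume_steiner_sdiff_ball_add_le`). Hence symmetrizations bring three sets simultaneously
as close to balls as desired, and no compactness argument is needed (`sumTriple_le_ball`).
-/

noncomputable section

open MeasureTheory Set
open scoped ENNReal RealInnerProductSpace Pointwise

namespace AnisotropicModulus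

/-! ### Riesz's inequality on the line -/

/-- The Riesz functional of three sets: the measure of the pairs `(x, y)` with `x ∈ A`, `y ∈ B` and
`x + y ∈ C`, that is `∫ 1_C · (1_A * 1_B)`. -/
def sumTriple {G : Type*} [Add G] [MeasureSpace G] (A B C : Set G) : ℝ≥0∞ :=
  volume {q : G × G | q.1 ∈ A ∧ q.2 ∈ B ∧ q.1 + q.2 ∈ C}

/-- The open interval of length `m` centred at `0`, and the whole line for `m = ∞`. The condition
`2 |s| < m` is stated in `[0, ∞]`, so that an interval of length `0` is empty. -/
def centeredInterval (m : ℝ≥0∞) : Set ℝ := {s | ENNReal.ofReal (2 * |s|) < m}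

theorem centeredInterval_ofReal (a : ℝ) :
    centeredInterval (ENNReal.ofReal a) = Ioo (-(a / 2)) (a / 2) := by
  ext s
  simp only [centeredInterval, mem_ofPred_eq, mem_Ioo, ← abs_lt]
  rw [ENNReal.ofReal_lt_ofReal_iff']
  constructor
  · rintro ⟨h, -⟩; linarith
  · intro h; have := abs_nonneg s; constructor <;> linarith

theorem measurableSet_sumTriple {G : Type*} [Add G] [MeasurableSpace G] [MeasurableAdd₂ G]
    {A B C : Set G} (hA : MeasurableSet A) (hB : MeasurableSet B) (hC : MeasurableSet C) :
    MeasurableSet {q : G × G | q.1 ∈ A ∧ q.2 ∈ B ∧ q.1 + q.2 ∈ C} :=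
  (measurable_fst hA).inter ((measurable_snd hB).inter (measurable_add hC))

theorem exists_volume_inter_Iic_eq {A : Set ℝ} (hA : Bornology.IsBounded A) {t : ℝ≥0∞}
    (ht : t ≤ volume A) : ∃ p, volume (A ∩ Iic p) = t := by
  have hfin : ∀ p, volume (A ∩ Iic p) ≠ ∞ := fun p =>
    (measure_mono inter_subset_left).trans_lt hA.measure_lt_top |>.ne
  have hlip : LipschitzWith 1 (fun p => (volume (A ∩ Iic p)).toReal) := by
    refine LipschitzWith.of_le_add fun x y => ?_
    have h : volume (A ∩ Iic x) ≤ volume (A ∩ Iic y) + ENNReal.ofReal (dist x y) := by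
      calc volume (A ∩ Iic x) ≤ volume (A ∩ Iic y ∪ Ioc y x) := by
            refine measure_mono fun z hz => ?_
            by_cases hzy : z ≤ y
            · exact Or.inl ⟨hz.1, hzy⟩
            · exact Or.inr ⟨not_le.1 hzy, hz.2⟩
        _ ≤ volume (A ∩ Iic y) + volume (Ioc y x) := measure_union_le _ _
        _ ≤ _ := by
            rw [Real.volume_Ioc]
            gcongr
            exact le_abs_self _
    have h2 := ENNReal.toReal_mono (by finiteness [hfin y]) h
    rwa [ENNReal.toReal_add (hfin y) (by finiteness), ENNReal.toReal_ofReal dist_nonneg] at h2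
  obtain ⟨M, hM⟩ := hA.subset_closedBall 0
  have hAM : ∀ x ∈ A, |x| ≤ M := fun x hx => by simpa using hM hx
  have htf : t ≠ ∞ := (ht.trans_lt hA.measure_lt_top).ne
  obtain ⟨p, hp⟩ := mem_range_of_exists_le_of_exists_ge hlip.continuous (c := t.toReal)
    ⟨-M - 1, by
      have : A ∩ Iic (-M - 1) = ∅ := by
        ext x
        simp only [mem_inter_iff, mem_Iic, mem_empty_iff_false, iff_false, not_and, not_le]
        intro hx
        have := (abs_le.1 (hAM x hx)).1
        linarith
      simp [this]⟩
    ⟨M, by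
      have : A ∩ Iic M = A := inter_eq_left.2 fun x hx => (abs_le.1 (hAM x hx)).2
      simp only [this]
      exact ENNReal.toReal_mono hA.measure_lt_top.ne ht⟩
  exact ⟨p, (ENNReal.toReal_eq_toReal_iff' (hfin p) htf).1 hp⟩

/-- The bound behind Riesz's inequality on the line. Cut off from `A` its leftmost part of measure
`t` and from `B` its rightmost part of measure `t`. What remains is a product of measure `(|A| -
t) (|B| - t)`, and a given sum `s` is attained on the discarded pairs by a set of `x` of measure
at most `t`. -/
theorem sumTriple_le_add_mul {A B C : Set ℝ} (hA : MeasurableSet A) (hB : MeasurableSet B)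
    (hC : MeasurableSet C) (hA' : Bornology.IsBounded A) (hB' : Bornology.IsBounded B)
    {t : ℝ≥0∞} (htA : t ≤ volume A) (htB : t ≤ volume B) :
    sumTriple A B C ≤ (volume A - t) * (volume B - t) + t * volume C := by
  have htf : t ≠ ∞ := (htA.trans_lt hA'.measure_lt_top).ne
  obtain ⟨p, hp⟩ := exists_volume_inter_Iic_eq hA' htA
  obtain ⟨q, hq⟩ := exists_volume_inter_Iic_eq hB' (tsub_le_self : volume B - t ≤ volume B)
  have hp' : volume (A ∩ Ioi p) = volume A - t := by
    have := measure_inter_add_sdiff (μ := volume) A (measurableSet_Iic (a := p))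
    rw [sdiff_eq, compl_Iic, hp] at this
    rw [← this, ENNReal.add_sub_cancel_left htf]
  have hq' : volume (B ∩ Ioi q) = t := by
    have := measure_inter_add_sdiff (μ := volume) B (measurableSet_Iic (a := q))
    rw [sdiff_eq, compl_Iic, hq] at this
    have h2 : volume B - t + t = volume B := tsub_add_cancel_of_le htB
    exact (ENNReal.add_right_inj (ENNReal.sub_ne_top hB'.measure_lt_top.ne)).1
      (this.trans h2.symm)
  set T : Set (ℝ × ℝ) := {z | z.1 ∈ A ∧ z.2 - z.1 ∈ B ∧ (z.1 ≤ p ∨ q < z.2 - z.1) ∧ z.2 ∈ C}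
  have hT : MeasurableSet T := by
    have hsub : Measurable fun z : ℝ × ℝ => z.2 - z.1 := by fun_prop
    exact (measurable_fst hA).inter ((hsub hB).inter
      (((measurable_fst measurableSet_Iic).union (hsub measurableSet_Ioi)).inter
        (measurable_snd hC)))
  have hTle : volume T ≤ t * volume C := by
    rw [Measure.volume_eq_prod, Measure.prod_apply_symm hT]
    calc ∫⁻ s, volume ((fun x => (x, s)) ⁻¹' T) ≤ ∫⁻ s, C.indicator (fun _ => t) s := by
          refine lintegral_mono fun s => ?_
          by_cases hs : s ∈ C
          · rw [indicator_of_mem hs]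
            -- On the line of sum `s` the two conditions `x ≤ p` and `x < s - q` are nested.
            rcases le_or_gt (s - q) p with h | h
            · refine (measure_mono ?_).trans hp.le
              rintro x ⟨hx1, -, hx2 | hx2, -⟩
              · exact ⟨hx1, hx2⟩
              · simp only at hx2
                exact ⟨hx1, by simp only [mem_Iic]; linarith⟩
            · refine (measure_mono (t := (fun x => s - x) ⁻¹' (B ∩ Ioi q)) ?_).trans ?_
              · rintro x ⟨-, hx1, hx2, -⟩
                refine ⟨hx1, ?_⟩
                simp only [mem_Ioi] at hx2 ⊢
                rcases hx2 with hx2 | hx2 <;> linarith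
              · exact ((Measure.measurePreserving_sub_left volume s).measure_preimage
                  (hB.inter measurableSet_Ioi).nullMeasurableSet).trans hq' |>.le
          · rw [indicator_of_notMem hs]
            refine le_of_eq (measure_mono_null (t := ∅) ?_ (by simp))
            rintro x ⟨-, -, -, hx⟩
            exact hs hx
      _ = t * volume C := by rw [lintegral_indicator_const hC]
  have hshear := measurePreserving_prod_add (volume : Measure ℝ) (volume : Measure ℝ)
  rw [sumTriple]
  calc volume {z : ℝ × ℝ | z.1 ∈ A ∧ z.2 ∈ B ∧ z.1 + z.2 ∈ C}
      ≤ volume ((A ∩ Ioi p) ×ˢ (B ∩ Iic q) ∪ (fun z : ℝ × ℝ => (z.1, z.1 + z.2)) ⁻¹' T) := by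
        refine measure_mono ?_
        rintro ⟨x, y⟩ ⟨hx, hy, hxy⟩
        simp only at hx hy hxy
        by_cases h : x ≤ p ∨ q < y
        · exact Or.inr ⟨hx, by simpa using hy, by simpa using h, hxy⟩
        · push Not at h
          exact Or.inl ⟨⟨hx, h.1⟩, hy, h.2⟩
    _ ≤ volume ((A ∩ Ioi p) ×ˢ (B ∩ Iic q)) + volume T := by
        refine (measure_union_le _ _).trans (add_le_add_right (le_of_eq ?_) _)
        exact hshear.measure_preimage hT.nullMeasurableSet
    _ ≤ _ := by
        rw [Measure.volume_eq_prod, Measure.prod_prod, hp', hq]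
        gcongr
        exact hTle

theorem sumTriple_comm {G : Type*} [AddCommGroup G] [MeasureSpace G]
    [SFinite (volume : Measure G)] (A B C : Set G) :
    sumTriple A B C = sumTriple B A C := by
  have h : MeasurePreserving (Prod.swap : G × G → G × G) volume volume :=
    Measure.measurePreserving_swap
  rw [sumTriple, ← h.measure_preimage_equiv (f := MeasurableEquiv.prodComm), sumTriple]
  congr 1
  ext ⟨x, y⟩
  simp only [mem_preimage, mem_ofPred_eq, MeasurableEquiv.prodComm, MeasurableEquiv.coe_mk,
    Equiv.prodComm_apply, Prod.swap, add_comm y x]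
  tauto

/-- If the middle interval is long, the constraint on `y` follows from the other two. -/
theorem mul_le_sumTriple_of_add_le {a b c : ℝ} (h : a + c ≤ b) :
    ENNReal.ofReal a * ENNReal.ofReal c ≤ sumTriple (Ioo (-(a / 2)) (a / 2))
      (Ioo (-(b / 2)) (b / 2)) (Ioo (-(c / 2)) (c / 2)) := by
  have hshear := measurePreserving_prod_add (volume : Measure ℝ) (volume : Measure ℝ)
  have hvol : ∀ r : ℝ, volume (Ioo (-(r / 2)) (r / 2)) = ENNReal.ofReal r := fun r => by
    rw [Real.volume_Ioo]; congr 1; ring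
  rw [← hvol a, ← hvol c, ← Measure.prod_prod, ← hshear.measure_preimage
    (measurableSet_Ioo.prod measurableSet_Ioo).nullMeasurableSet, sumTriple]
  refine measure_mono ?_
  rintro ⟨x, y⟩ ⟨hx, hxy⟩
  simp only [mem_Ioo] at hx hxy
  refine ⟨hx, ⟨?_, ?_⟩, hxy⟩ <;> simp only <;> linarith [hx.1, hx.2, hxy.1, hxy.2]

/-- The area of the triangle cut off from a corner of a rectangle by a line of slope `-1`. -/
theorem volume_corner_le (l r m : ℝ) (h : l ≤ r) :
    volume {z : ℝ × ℝ | z.1 < r ∧ z.2 < m ∧ l + m ≤ z.1 + z.2} ≤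
      ENNReal.ofReal ((r - l) ^ 2 / 2) := by
  have hm : MeasurableSet {z : ℝ × ℝ | z.1 < r ∧ z.2 < m ∧ l + m ≤ z.1 + z.2} :=
    (measurable_fst measurableSet_Iio).inter ((measurable_snd measurableSet_Iio).inter
      (measurable_add measurableSet_Ici))
  rw [Measure.volume_eq_prod, Measure.prod_apply hm]
  calc ∫⁻ x, volume (Prod.mk x ⁻¹' {z : ℝ × ℝ | z.1 < r ∧ z.2 < m ∧ l + m ≤ z.1 + z.2})
      ≤ ∫⁻ x, (Ioc l r).indicator (fun x => ENNReal.ofReal (x - l)) x := by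
        refine lintegral_mono fun x => ?_
        by_cases hx : x ∈ Ioc l r
        · rw [indicator_of_mem hx]
          refine (measure_mono (t := Ico (l + m - x) m) ?_).trans ?_
          · rintro y ⟨-, h2, h3⟩
            simp only at h2 h3
            exact ⟨by linarith, h2⟩
          · rw [Real.volume_Ico]
            exact ENNReal.ofReal_le_ofReal (by linarith)
        · rw [indicator_of_notMem hx]
          refine le_of_eq (measure_mono_null (t := ∅) ?_ (by simp))
          rintro y ⟨h1, h2, h3⟩
          simp only at h1 h2 h3
          exact hx ⟨by linarith, h1.le⟩
    _ = ENNReal.ofReal ((r - l) ^ 2 / 2) := by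
        rw [lintegral_indicator measurableSet_Ioc, ← ofReal_integral_eq_lintegral_ofReal,
          ← intervalIntegral.integral_of_le h]
        · congr 1
          rw [intervalIntegral.integral_comp_sub_right (fun x => x)]
          simp
        · exact (Continuous.integrableOn_Icc (by fun_prop)).mono_set Ioc_subset_Icc_self
        · exact (ae_restrict_iff' measurableSet_Ioc).2 (.of_forall fun x hx => by
            simpa using hx.1.le)

/-- For centred intervals whose lengths satisfy the triangle inequalities, the bound of
`sumTriple_le_add_mul` with `t = (a + b - c) / 2` is attained: its value is `a b - t²`, and the
strip `|x + y| < c / 2` misses only two corner triangles of area `t² / 2` of the rectangle. -/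
theorem le_sumTriple_Ioo {a b c : ℝ} (ha : 0 ≤ a) (hab : c ≤ a + b)
    (hba : b ≤ a + c) (hac : a ≤ b + c) :
    ENNReal.ofReal ((a - (a + b - c) / 2) * (b - (a + b - c) / 2) + (a + b - c) / 2 * c) ≤
      sumTriple (Ioo (-(a / 2)) (a / 2)) (Ioo (-(b / 2)) (b / 2)) (Ioo (-(c / 2)) (c / 2)) := by
  have hvol : ∀ r : ℝ, volume (Ioo (-(r / 2)) (r / 2)) = ENNReal.ofReal r := fun r => by
    rw [Real.volume_Ioo]; congr 1; ring
  set S := sumTriple (Ioo (-(a / 2)) (a / 2)) (Ioo (-(b / 2)) (b / 2)) (Ioo (-(c / 2)) (c / 2))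
  set T := {z : ℝ × ℝ | z.1 < a / 2 ∧ z.2 < b / 2 ∧ (c - b) / 2 + b / 2 ≤ z.1 + z.2} with hT
  have hTle : volume T ≤ ENNReal.ofReal ((a / 2 - (c - b) / 2) ^ 2 / 2) :=
    volume_corner_le _ _ _ (by linarith)
  have key : ENNReal.ofReal (a * b) ≤ S + 2 * ENNReal.ofReal ((a / 2 - (c - b) / 2) ^ 2 / 2) := by
    calc ENNReal.ofReal (a * b)
        = volume (Ioo (-(a / 2)) (a / 2) ×ˢ Ioo (-(b / 2)) (b / 2)) := by
          rw [Measure.volume_eq_prod, Measure.prod_prod, hvol, hvol, ENNReal.ofReal_mul ha]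
      _ ≤ volume ({z : ℝ × ℝ | z.1 ∈ Ioo (-(a / 2)) (a / 2) ∧ z.2 ∈ Ioo (-(b / 2)) (b / 2) ∧
            z.1 + z.2 ∈ Ioo (-(c / 2)) (c / 2)} ∪ (T ∪ Neg.neg ⁻¹' T)) := by
          refine measure_mono ?_
          rintro ⟨x, y⟩ ⟨hx, hy⟩
          simp only [mem_Ioo] at hx hy
          simp only [mem_union, mem_ofPred_eq, mem_Ioo, mem_preimage, hT, Prod.fst_neg,
            Prod.snd_neg]
          by_cases h1 : x + y < c / 2
          · by_cases h2 : -(c / 2) < x + y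
            · exact Or.inl ⟨hx, hy, h2, h1⟩
            · refine Or.inr (Or.inr ⟨?_, ?_, ?_⟩) <;> linarith [hx.1, hy.1]
          · refine Or.inr (Or.inl ⟨?_, ?_, ?_⟩) <;> linarith [hx.2, hy.2]
      _ ≤ S + (volume T + volume (Neg.neg ⁻¹' T)) :=
          (measure_union_le _ _).trans (add_le_add_right (measure_union_le _ _) _)
      _ ≤ _ := by
          have : volume (Neg.neg ⁻¹' T) = volume T := Measure.measure_preimage_neg _ _
          rw [this, two_mul]
          gcongr
  have h2 : (2 : ℝ≥0∞) * ENNReal.ofReal ((a / 2 - (c - b) / 2) ^ 2 / 2) =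
      ENNReal.ofReal ((a / 2 - (c - b) / 2) ^ 2) := by
    rw [← ENNReal.ofReal_ofNat 2, ← ENNReal.ofReal_mul (by norm_num)]
    congr 1; ring
  rw [h2] at key
  refine (ENNReal.add_le_add_iff_right
    (ENNReal.ofReal_ne_top (r := (a / 2 - (c - b) / 2) ^ 2))).1 (le_trans (le_of_eq ?_) key)
  have hc : 0 ≤ c := by linarith
  rw [← ENNReal.ofReal_add _ (sq_nonneg _)]
  · congr 1; ring
  · have h1 : 0 ≤ a - (a + b - c) / 2 := by linarith
    have h2 : 0 ≤ b - (a + b - c) / 2 := by linarith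
    have h3 : 0 ≤ (a + b - c) / 2 := by linarith
    positivity

/-- Riesz's rearrangement inequality on the line, for bounded sets. -/
theorem sumTriple_le_centeredInterval {A B C : Set ℝ} (hA : MeasurableSet A)
    (hB : MeasurableSet B) (hC : MeasurableSet C) (hA' : Bornology.IsBounded A)
    (hB' : Bornology.IsBounded B) (hC' : Bornology.IsBounded C) :
    sumTriple A B C ≤ sumTriple (centeredInterval (volume A)) (centeredInterval (volume B))
      (centeredInterval (volume C)) := by
  wlog hle : volume A ≤ volume B generalizing A B
  · rw [sumTriple_comm, sumTriple_comm (centeredInterval _)]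
    exact this hB hA hB' hA' (le_of_not_ge hle)
  have hvol : ∀ {S : Set ℝ}, Bornology.IsBounded S → ∃ r : ℝ, 0 ≤ r ∧ volume S = ENNReal.ofReal r :=
    fun hS => ⟨_, ENNReal.toReal_nonneg, (ENNReal.ofReal_toReal hS.measure_lt_top.ne).symm⟩
  obtain ⟨a, ha, hAa⟩ := hvol hA'
  obtain ⟨b, hb, hBb⟩ := hvol hB'
  obtain ⟨c, hc, hCc⟩ := hvol hC'
  have key := fun t => sumTriple_le_add_mul hA hB hC hA' hB' (t := ENNReal.ofReal t)
  rw [hAa, hBb] at hle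
  simp only [hAa, hBb, hCc, centeredInterval_ofReal] at key ⊢
  rw [ENNReal.ofReal_le_ofReal_iff hb] at hle
  -- The optimal cut is `t = (a + b - c) / 2`, clamped to `[0, min a b]`.
  rcases le_total (a + c) b with h1 | h1
  · refine (key a le_rfl (ENNReal.ofReal_le_ofReal hle)).trans ?_
    simpa using mul_le_sumTriple_of_add_le h1
  rcases le_total (a + b) c with h2 | h2
  · refine (key 0 (by simp) (by simp)).trans ?_
    rw [ENNReal.ofReal_zero, zero_mul, add_zero, tsub_zero, tsub_zero]
    have hvol : ∀ r : ℝ, volume (Ioo (-(r / 2)) (r / 2)) = ENNReal.ofReal r := fun r => by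
      rw [Real.volume_Ioo]; congr 1; ring
    rw [← hvol a, ← hvol b, ← Measure.prod_prod, sumTriple]
    refine measure_mono ?_
    rintro ⟨x, y⟩ ⟨hx, hy⟩
    simp only [mem_Ioo] at hx hy
    refine ⟨hx, hy, ?_, ?_⟩ <;> simp only <;> linarith [hx.1, hx.2, hy.1, hy.2]
  · have ht : 0 ≤ (a + b - c) / 2 := by linarith
    refine (key ((a + b - c) / 2) (ENNReal.ofReal_le_ofReal (by linarith))
      (ENNReal.ofReal_le_ofReal (by linarith))).trans
      (le_trans (le_of_eq ?_) (le_sumTriple_Ioo ha h2 h1 (by linarith)))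
    rw [← ENNReal.ofReal_sub _ ht, ← ENNReal.ofReal_sub _ ht, ← ENNReal.ofReal_mul (by linarith),
      ← ENNReal.ofReal_mul ht, ← ENNReal.ofReal_add _ (by positivity)]
    exact mul_nonneg (by linarith) (by linarith)

/-! ### Steiner symmetrization -/

theorem volume_centeredInterval (m : ℝ≥0∞) : volume (centeredInterval m) = m := by
  induction m with
  | top =>
    have : centeredInterval ∞ = univ := by
      ext
      simp [centeredInterval, -ENNReal.ofReal_mul, ENNReal.ofReal_lt_top]
    simp [this]
  | coe a =>
    rw [← ENNReal.ofReal_coe_nnreal, centeredInterval_ofReal, Real.volume_Ioo]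
    congr 1; ring

/-- A symmetric interval contains every shorter open symmetric interval. -/
theorem centeredInterval_subset {J : Set ℝ} (hJ : J.OrdConnected) (hneg : ∀ s ∈ J, -s ∈ J)
    {m : ℝ≥0∞} (hm : m ≤ volume J) : centeredInterval m ⊆ J := by
  intro s hs
  by_contra hsJ
  have hsub : J ⊆ Icc (-|s|) |s| := by
    intro r hr
    rw [mem_Icc, ← abs_le]
    by_contra! h
    have habs : |r| ∈ J := by rcases abs_cases r with h | h <;> rw [h.1]; exacts [hr, hneg r hr]
    exact hsJ (hJ.out (hneg _ habs) habs (abs_le.1 h.le))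
  have : volume J ≤ ENNReal.ofReal (2 * |s|) := by
    refine (measure_mono hsub).trans (le_of_eq ?_)
    rw [Real.volume_Icc]; congr 1; ring
  exact absurd (hm.trans this) (not_le.2 hs)

variable {E : Type*} [NormedAddCommGroup E] [InnerProductSpace ℝ E]

/-- The section of `A` by the line through `x` in direction `u`, parametrized by `s ↦ x + s • u`.
The base point is any point of the line, which avoids choosing a complement of `u`. -/
def lineSection (u : E) (A : Set E) (x : E) : Set ℝ := {s | x + s • u ∈ A}

theorem isBounded_lineSection {u : E} (hu : ‖u‖ = 1) {A : Set E} (hA : Bornology.IsBounded A)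
    (x : E) : Bornology.IsBounded (lineSection u A x) := by
  obtain ⟨M, hM⟩ := hA.subset_closedBall 0
  refine (Metric.isBounded_closedBall (x := (0 : ℝ)) (r := M + ‖x‖)).subset fun s hs => ?_
  have h1 : ‖x + s • u‖ ≤ M := by simpa using hM hs
  have h2 : ‖s • u‖ ≤ ‖x + s • u‖ + ‖x‖ := by
    simpa using norm_sub_le (x + s • u) x
  rw [norm_smul, hu, mul_one] at h2
  simpa using h2.trans (by linarith)

theorem lineSection_add_smul (u : E) (A : Set E) (x : E) (r : ℝ) :
    lineSection u A (x + r • u) = (fun s => r + s) ⁻¹' lineSection u A x := by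
  ext s
  simp [lineSection, add_smul, add_assoc]

theorem norm_sq_add_smul {u : E} (hu : ‖u‖ = 1) (x : E) (s : ℝ) :
    ‖x + (s - ⟪u, x⟫) • u‖ ^ 2 = ‖x‖ ^ 2 - ⟪u, x⟫ ^ 2 + s ^ 2 := by
  rw [norm_add_sq_real, norm_smul, hu, inner_smul_right, real_inner_comm u x, Real.norm_eq_abs,
    mul_one, sq_abs]
  ring

/-- The section of a centred ball is an interval symmetric about `-⟪u, x⟫`, hence contains every
shorter interval with that centre. -/
theorem centeredInterval_subset_lineSection_ball {u : E} (hu : ‖u‖ = 1) (x : E) (r : ℝ)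
    {m : ℝ≥0∞} (hm : m ≤ volume (lineSection u (Metric.ball 0 r) x)) {s : ℝ}
    (hs : ⟪u, x⟫ + s ∈ centeredInterval m) : s ∈ lineSection u (Metric.ball 0 r) x := by
  have h := centeredInterval_subset
    (J := (fun s => -⟪u, x⟫ + s) ⁻¹' lineSection u (Metric.ball 0 r) x) (m := m) ?_ ?_ ?_ hs
  · simpa using h
  · refine ⟨fun a ha b hb c hc => ?_⟩
    simp only [lineSection, mem_preimage, mem_ofPred_eq, mem_ball_zero_iff] at ha hb ⊢
    rw [neg_add_eq_sub] at *
    by_cases h0 : c ≤ 0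
    · refine lt_of_le_of_lt ?_ ha
      rw [← sq_le_sq₀ (norm_nonneg _) (norm_nonneg _), norm_sq_add_smul hu, norm_sq_add_smul hu]
      nlinarith [hc.1]
    · refine lt_of_le_of_lt ?_ hb
      rw [← sq_le_sq₀ (norm_nonneg _) (norm_nonneg _), norm_sq_add_smul hu, norm_sq_add_smul hu]
      nlinarith [hc.2]
  · intro s hs
    simp only [lineSection, mem_preimage, mem_ofPred_eq, mem_ball_zero_iff] at hs ⊢
    rw [neg_add_eq_sub] at *
    refine lt_of_le_of_lt ?_ hs
    rw [← sq_le_sq₀ (norm_nonneg _) (norm_nonneg _), norm_sq_add_smul hu, norm_sq_add_smul hu]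
    simp
  · rwa [measure_preimage_add]

/-- Steiner symmetral of `A` in the direction of a unit vector `u`: each section of `A` parallel to
`u` is replaced by the open interval of the same length centred on the hyperplane `u^⊥`. -/
def steiner (u : E) (A : Set E) : Set E :=
  {x | ENNReal.ofReal (2 * |⟪u, x⟫|) < volume (lineSection u A x)}

theorem lineSection_steiner {u : E} (hu : ‖u‖ = 1) (A : Set E) (x : E) :
    lineSection u (steiner u A) x =
      (fun s => ⟪u, x⟫ + s) ⁻¹' centeredInterval (volume (lineSection u A x)) := by
  ext s
  simp only [steiner, centeredInterval, mem_preimage, mem_ofPred_eq]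
  rw [lineSection, mem_ofPred_eq, mem_ofPred_eq, lineSection_add_smul, measure_preimage_add,
    inner_add_right, inner_smul_right, real_inner_self_eq_norm_sq, hu]
  simp

theorem volume_lineSection_steiner {u : E} (hu : ‖u‖ = 1) (A : Set E) (x : E) :
    volume (lineSection u (steiner u A) x) = volume (lineSection u A x) := by
  rw [lineSection_steiner hu, measure_preimage_add, volume_centeredInterval]

theorem steiner_subset_ball {u : E} (hu : ‖u‖ = 1) {A : Set E} {R : ℝ}
    (hA : A ⊆ Metric.ball 0 R) : steiner u A ⊆ Metric.ball 0 R := by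
  intro x hx
  have h : volume (lineSection u A x) ≤ volume (lineSection u (Metric.ball 0 R) x) :=
    measure_mono fun s hs => hA hs
  have := centeredInterval_subset_lineSection_ball hu x R h (s := 0)
    (by rw [add_zero]; exact hx)
  simpa [lineSection] using this

variable [MeasurableSpace E] [BorelSpace E]

theorem measurableSet_lineSection (u : E) {A : Set E} (hA : MeasurableSet A) (x : E) :
    MeasurableSet (lineSection u A x) :=
  hA.preimage (f := fun s : ℝ => x + s • u) (by fun_prop)

variable [FiniteDimensional ℝ E]

theorem measurableSet_steiner (u : E) {A : Set E} (hA : MeasurableSet A) :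
    MeasurableSet (steiner u A) := by
  have h : Measurable fun x : E => volume (lineSection u A x) :=
    measurable_measure_prodMk_left (s := {z : E × ℝ | z.1 + z.2 • u ∈ A})
      (hA.preimage (by fun_prop))
  exact measurableSet_lt (by fun_prop) h

/-- Fubini's theorem along a direction: since the line integral depends only on the line, each
line may be counted by its points with `⟪u, x⟫ ∈ (0, 1]`, a set of length one. -/
theorem lintegral_eq_lintegral_line {u : E} (hu : ‖u‖ = 1) {F : E → ℝ≥0∞} (hF : Measurable F) :
    ∫⁻ x, F x = ∫⁻ x in {x | ⟪u, x⟫ ∈ Ioc (0 : ℝ) 1}, ∫⁻ s : ℝ, F (x + s • u) := by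
  have hmeas : Measurable fun z : E × ℝ => F (z.1 + z.2 • u) := hF.comp (by fun_prop)
  have hS : MeasurableSet {x : E | ⟪u, x⟫ ∈ Ioc (0 : ℝ) 1} :=
    measurableSet_Ioc.preimage (f := fun x : E => ⟪u, x⟫) (by fun_prop)
  have hind : Measurable (indicator {x : E | ⟪u, x⟫ ∈ Ioc (0 : ℝ) 1} (1 : E → ℝ≥0∞)) :=
    measurable_one.indicator hS
  symm
  calc ∫⁻ x in {x | ⟪u, x⟫ ∈ Ioc (0 : ℝ) 1}, ∫⁻ s : ℝ, F (x + s • u)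
      = ∫⁻ s : ℝ, ∫⁻ x in {x | ⟪u, x⟫ ∈ Ioc (0 : ℝ) 1}, F (x + s • u) :=
        lintegral_lintegral_swap hmeas.aemeasurable
    _ = ∫⁻ s : ℝ, ∫⁻ x : E, indicator {x : E | ⟪u, x⟫ ∈ Ioc (0 : ℝ) 1} 1 (x - s • u) * F x := by
        refine lintegral_congr fun s => ?_
        rw [← lintegral_indicator hS, ← lintegral_add_right_eq_self (μ := volume)
          (fun x : E => indicator {x : E | ⟪u, x⟫ ∈ Ioc (0 : ℝ) 1} 1 (x - s • u) * F x) (s • u)]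
        refine lintegral_congr fun x => ?_
        by_cases hx : x ∈ {x : E | ⟪u, x⟫ ∈ Ioc (0 : ℝ) 1}
        · simp only [add_sub_cancel_right, indicator_of_mem hx, Pi.one_apply, one_mul]
        · simp only [add_sub_cancel_right, indicator_of_notMem hx, zero_mul]
    _ = ∫⁻ x : E, ∫⁻ s : ℝ, indicator {x : E | ⟪u, x⟫ ∈ Ioc (0 : ℝ) 1} 1 (x - s • u) * F x := by
        refine lintegral_lintegral_swap (Measurable.aemeasurable ?_)
        exact (hind.comp (by fun_prop : Measurable fun z : ℝ × E => z.2 - z.1 • u)).mul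
          (hF.comp measurable_snd)
    _ = ∫⁻ x, F x := by
        refine lintegral_congr fun x => ?_
        have hm : Measurable fun s : ℝ => x - s • u := by fun_prop
        rw [lintegral_mul_const _
          (f := fun s => indicator {x : E | ⟪u, x⟫ ∈ Ioc (0 : ℝ) 1} 1 (x - s • u)) (hind.comp hm)]
        have : ∀ s : ℝ, indicator {x : E | ⟪u, x⟫ ∈ Ioc (0 : ℝ) 1} (1 : E → ℝ≥0∞) (x - s • u) =
            indicator (Ico (⟪u, x⟫ - 1) ⟪u, x⟫) 1 s := by
          intro s
          simp only [indicator, mem_ofPred_eq, inner_sub_right, inner_smul_right,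
            real_inner_self_eq_norm_sq, hu, mem_Ioc, mem_Ico, Pi.one_apply]
          refine if_congr ⟨fun h => ⟨?_, ?_⟩, fun h => ⟨?_, ?_⟩⟩ rfl rfl <;> linarith [h.1, h.2]
        simp only [this]
        rw [lintegral_indicator_one measurableSet_Ico, Real.volume_Ico]
        simp

theorem volume_eq_lintegral_lineSection {u : E} (hu : ‖u‖ = 1) {A : Set E} (hA : MeasurableSet A) :
    volume A = ∫⁻ x in {x | ⟪u, x⟫ ∈ Ioc (0 : ℝ) 1}, volume (lineSection u A x) := by
  rw [← lintegral_indicator_one hA, lintegral_eq_lintegral_line hu (measurable_one.indicator hA)]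
  refine lintegral_congr fun x => ?_
  rw [← lintegral_indicator_one (measurableSet_lineSection u hA x)]
  rfl

theorem volume_steiner {u : E} (hu : ‖u‖ = 1) {A : Set E} (hA : MeasurableSet A) :
    volume (steiner u A) = volume A := by
  rw [volume_eq_lintegral_lineSection hu hA,
    volume_eq_lintegral_lineSection hu (measurableSet_steiner u hA)]
  simp only [volume_lineSection_steiner hu]

theorem sumTriple_eq_lintegral_lineSection {u : E} (hu : ‖u‖ = 1) {A B C : Set E}
    (hA : MeasurableSet A) (hB : MeasurableSet B) (hC : MeasurableSet C) :
    sumTriple A B C = ∫⁻ x in {x | ⟪u, x⟫ ∈ Ioc (0 : ℝ) 1}, ∫⁻ y in {x | ⟪u, x⟫ ∈ Ioc (0 : ℝ) 1},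
      sumTriple (lineSection u A x) (lineSection u B y) (lineSection u C (x + y)) := by
  have hO := measurableSet_sumTriple hA hB hC
  set O := {q : E × E | q.1 ∈ A ∧ q.2 ∈ B ∧ q.1 + q.2 ∈ C} with hOdef
  set I : E × E → ℝ≥0∞ := O.indicator 1 with hI
  have hIm : Measurable I := measurable_one.indicator hO
  calc sumTriple A B C = ∫⁻ x, ∫⁻ y, I (x, y) := by
        rw [sumTriple, ← hOdef, ← lintegral_indicator_one hO, Measure.volume_eq_prod,
          lintegral_prod _ hIm.aemeasurable]
    _ = ∫⁻ x in {x | ⟪u, x⟫ ∈ Ioc (0 : ℝ) 1}, ∫⁻ s : ℝ, ∫⁻ y, I (x + s • u, y) :=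
        lintegral_eq_lintegral_line hu hIm.lintegral_prod_right'
    _ = ∫⁻ x in {x | ⟪u, x⟫ ∈ Ioc (0 : ℝ) 1}, ∫⁻ y in {x | ⟪u, x⟫ ∈ Ioc (0 : ℝ) 1},
          ∫⁻ s : ℝ, ∫⁻ r : ℝ, I (x + s • u, y + r • u) := by
        refine lintegral_congr fun x => ?_
        rw [lintegral_lintegral_swap
          (f := fun (y : E) (s : ℝ) => ∫⁻ r : ℝ, I (x + s • u, y + r • u))]
        · refine lintegral_congr fun s => ?_
          exact lintegral_eq_lintegral_line hu (hIm.comp measurable_prodMk_left)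
        · refine Measurable.aemeasurable (Measurable.lintegral_prod_right'
            (f := fun z : (E × ℝ) × ℝ => I (x + z.1.2 • u, z.1.1 + z.2 • u)) ?_)
          exact hIm.comp (by fun_prop)
    _ = _ := by
        refine lintegral_congr fun x => lintegral_congr fun y => ?_
        have hM := measurableSet_sumTriple (measurableSet_lineSection u hA x)
          (measurableSet_lineSection u hB y) (measurableSet_lineSection u hC (x + y))
        rw [sumTriple, ← lintegral_indicator_one hM, Measure.volume_eq_prod,
          lintegral_prod _ (measurable_one.indicator hM).aemeasurable]
        refine lintegral_congr fun s => lintegral_congr fun r => ?_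
        have : x + s • u + (y + r • u) = x + y + (s + r) • u := by rw [add_smul]; abel
        have hiff : (x + s • u, y + r • u) ∈ O ↔ (s, r) ∈ {q : ℝ × ℝ | q.1 ∈ lineSection u A x ∧
            q.2 ∈ lineSection u B y ∧ q.1 + q.2 ∈ lineSection u C (x + y)} := by
          simp only [hOdef, lineSection, mem_ofPred_eq, this]
        by_cases h : (x + s • u, y + r • u) ∈ O
        · rw [hI, indicator_of_mem h, indicator_of_mem (hiff.1 h)]; rfl
        · rw [hI, indicator_of_notMem h, indicator_of_notMem (fun h' => h (hiff.2 h'))]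

/-- Steiner symmetrization does not decrease the Riesz functional: apply the one-dimensional
inequality to the sections along the lines through `x`, `y` and `x + y`, whose centres are again
additive. -/
theorem sumTriple_le_steiner {u : E} (hu : ‖u‖ = 1) {A B C : Set E}
    (hA : MeasurableSet A) (hB : MeasurableSet B) (hC : MeasurableSet C)
    (hA' : Bornology.IsBounded A) (hB' : Bornology.IsBounded B) (hC' : Bornology.IsBounded C) :
    sumTriple A B C ≤ sumTriple (steiner u A) (steiner u B) (steiner u C) := by
  rw [sumTriple_eq_lintegral_lineSection hu hA hB hC, sumTriple_eq_lintegral_lineSection hu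
    (measurableSet_steiner u hA) (measurableSet_steiner u hB) (measurableSet_steiner u hC)]
  refine lintegral_mono fun x => lintegral_mono fun y => ?_
  refine (sumTriple_le_centeredInterval (measurableSet_lineSection u hA x)
    (measurableSet_lineSection u hB y) (measurableSet_lineSection u hC (x + y))
    (isBounded_lineSection hu hA' x) (isBounded_lineSection hu hB' y)
    (isBounded_lineSection hu hC' (x + y))).trans (le_of_eq ?_)
  simp only [lineSection_steiner hu]
  rw [sumTriple, sumTriple, ← measure_preimage_add volume ((⟪u, x⟫, ⟪u, y⟫) : ℝ × ℝ)]
  congr 1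
  ext ⟨s, r⟩
  simp only [mem_preimage, mem_ofPred_eq, Prod.fst_add, Prod.snd_add, inner_add_right]
  rw [add_add_add_comm]

/-! ### Riesz's inequality for balls -/

/-- Steiner symmetrization makes the part of `A` outside a ball smaller, at least by the measure
of the points outside the ball that a translation along `u` moves into the part of the ball missed
by `A`. On each line the symmetrized section is nested with the section of the ball, so the gain
there is the smaller of the measures of the two differences. -/
theorem volume_steiner_sdiff_ball_add_le {u : E} (hu : ‖u‖ = 1) {A : Set E} (hA : MeasurableSet A)
    (hA' : Bornology.IsBounded A) (r τ : ℝ) :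
    volume (steiner u A \ Metric.ball 0 r) +
        volume ((A \ Metric.ball 0 r) ∩ (fun x => x + τ • u) ⁻¹' (Metric.ball 0 r \ A)) ≤
      volume (A \ Metric.ball 0 r) := by
  have hb : MeasurableSet (Metric.ball (0 : E) r) := Metric.isOpen_ball.measurableSet
  have hS := measurableSet_steiner u hA
  have hm : Measurable fun x : E => x + τ • u := by fun_prop
  have hI := (hA.diff hb).inter (hm (hb.diff hA))
  have hmeas : Measurable fun x : E => volume (lineSection u (steiner u A \ Metric.ball 0 r) x) :=
    measurable_measure_prodMk_left
      (s := {z : E × ℝ | z.1 + z.2 • u ∈ steiner u A \ Metric.ball 0 r})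
      ((hS.diff hb).preimage (by fun_prop))
  rw [volume_eq_lintegral_lineSection hu (hS.diff hb), volume_eq_lintegral_lineSection hu hI,
    volume_eq_lintegral_lineSection hu (hA.diff hb), ← lintegral_add_left hmeas]
  refine lintegral_mono fun x => ?_
  set α := lineSection u A x with hα
  set J := lineSection u (Metric.ball 0 r) x with hJ
  have hαm : MeasurableSet α := measurableSet_lineSection u hA x
  have hJm : MeasurableSet J := measurableSet_lineSection u hb x
  have hαf : volume α ≠ ∞ := (isBounded_lineSection hu hA' x).measure_lt_top.ne
  have hJf : volume J ≠ ∞ := (isBounded_lineSection hu Metric.isBounded_ball x).measure_lt_top.ne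
  have e1 : lineSection u (steiner u A \ Metric.ball 0 r) x = lineSection u (steiner u A) x \ J :=
    rfl
  have e2 : lineSection u (A \ Metric.ball 0 r) x = α \ J := rfl
  have e3 : lineSection u ((A \ Metric.ball 0 r) ∩
      (fun x => x + τ • u) ⁻¹' (Metric.ball 0 r \ A)) x =
        (α \ J) ∩ (fun s => s + τ) ⁻¹' (J \ α) := by
    ext s
    simp only [lineSection, mem_inter_iff, mem_preimage, mem_ofPred_eq, mem_sdiff, hα, hJ, add_smul,
      add_assoc]
  have hSx := lineSection_steiner hu A x
  have hvS := volume_lineSection_steiner hu A x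
  simp only [e1, e2, e3]
  rcases le_total (volume α) (volume J) with h | h
  · have : lineSection u (steiner u A) x \ J = ∅ := by
      rw [sdiff_eq_empty, hSx]
      intro s hs
      exact centeredInterval_subset_lineSection_ball hu x r h hs
    rw [this, measure_empty, zero_add]
    exact measure_mono inter_subset_left
  · have hsub : volume (lineSection u (steiner u A) x \ J) ≤ volume α - volume J := by
      have hsubset : (fun s => ⟪u, x⟫ + s) ⁻¹' centeredInterval (volume J) ⊆
          lineSection u (steiner u A) x ∩ J := by
        intro s hs
        refine ⟨?_, centeredInterval_subset_lineSection_ball hu x r le_rfl hs⟩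
        rw [hSx]
        exact lt_of_lt_of_le (show _ < _ from hs) h
      have h1 := measure_inter_add_sdiff (μ := volume) (lineSection u (steiner u A) x) hJm
      have h2 : volume J ≤ volume (lineSection u (steiner u A) x ∩ J) := by
        refine le_trans (le_of_eq ?_) (measure_mono hsubset)
        rw [measure_preimage_add, volume_centeredInterval]
      refine ENNReal.le_sub_of_add_le_right hJf ?_
      rw [← hvS, ← h1, add_comm]
      gcongr
    have h3 : volume ((α \ J) ∩ (fun s => s + τ) ⁻¹' (J \ α)) ≤ volume (J \ α) :=
      (measure_mono inter_subset_right).trans (measure_preimage_add_right _ _ _).le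
    refine (add_le_add hsub h3).trans ?_
    have h4 := measure_inter_add_sdiff (μ := volume) α hJm
    have h5 := measure_inter_add_sdiff (μ := volume) J hαm
    have h6 : volume (α ∩ J) ≠ ∞ := ((measure_mono inter_subset_left).trans_lt hαf.lt_top).ne
    refine le_of_eq ?_
    rw [← h4, ← h5, inter_comm J α, ENNReal.add_sub_add_eq_sub_left h6]
    refine tsub_add_cancel_of_le ?_
    rw [← h4, ← h5, inter_comm J α] at h
    exact (ENNReal.add_le_add_iff_left h6).1 h

theorem volume_steiner_sdiff_ball_le {u : E} (hu : ‖u‖ = 1) {A : Set E} (hA : MeasurableSet A)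
    (hA' : Bornology.IsBounded A) (r : ℝ) :
    volume (steiner u A \ Metric.ball 0 r) ≤ volume (A \ Metric.ball 0 r) :=
  le_self_add.trans (volume_steiner_sdiff_ball_add_le hu hA hA' r 0)

/-- The measure of the points of `P` that a translation moves into `Q`, integrated over all
translations. -/
theorem lintegral_volume_inter_preimage_add {P Q : Set E} (hP : MeasurableSet P)
    (hQ : MeasurableSet Q) :
    ∫⁻ h, volume (P ∩ (fun x => x + h) ⁻¹' Q) = volume P * volume Q := by
  have hshear := measurePreserving_prod_add (volume : Measure E) (volume : Measure E)
  have hm : MeasurableSet ((fun z : E × E => (z.1, z.1 + z.2)) ⁻¹' (P ×ˢ Q)) :=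
    hshear.measurable (hP.prod hQ)
  rw [← Measure.prod_prod, ← hshear.measure_preimage (hP.prod hQ).nullMeasurableSet,
    Measure.prod_apply_symm hm]
  rfl

/-- Some Steiner symmetrization decreases the defect `|A \ ball|` by an amount depending only on its
size and on `R`: averaged over the translations of length less than `2 R`, the measure moved from
`A \ ball` into `ball \ A` is at least `|A \ ball|² / |ball (2 R)|`. The factor `2` in the
denominator makes an inequality strict. -/
theorem exists_volume_steiner_sdiff_ball_add_le {A : Set E} (hA : MeasurableSet A) {r R : ℝ}
    (hAR : A ⊆ Metric.ball 0 R) (hrR : r ≤ R) (hAr : volume A ≤ volume (Metric.ball (0 : E) r))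
    (h0 : volume (A \ Metric.ball 0 r) ≠ 0) :
    ∃ u : E, ‖u‖ = 1 ∧ volume (steiner u A \ Metric.ball 0 r) +
      volume (A \ Metric.ball 0 r) ^ 2 / (2 * volume (Metric.ball (0 : E) (2 * R))) ≤
        volume (A \ Metric.ball 0 r) := by
  have hb : MeasurableSet (Metric.ball (0 : E) r) := Metric.isOpen_ball.measurableSet
  have hA' : Bornology.IsBounded A := Metric.isBounded_ball.subset hAR
  set P := A \ Metric.ball 0 r with hP
  set Q := Metric.ball 0 r \ A with hQ
  set V := volume (Metric.ball (0 : E) (2 * R)) with hV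
  have hPm : MeasurableSet P := hA.diff hb
  have hQm : MeasurableSet Q := hb.diff hA
  have hPf : volume P ≠ ∞ := ((measure_mono sdiff_subset).trans_lt hA'.measure_lt_top).ne
  have hVf : V ≠ ∞ := measure_ball_lt_top.ne
  have hR : 0 < R := by
    obtain ⟨x, hx⟩ := nonempty_of_measure_ne_zero h0
    exact Metric.pos_of_mem_ball (hAR hx.1)
  have hV0 : V ≠ 0 := (Metric.measure_ball_pos _ _ (by linarith)).ne'
  have hPQ : volume P ≤ volume Q := by
    have h4 := measure_inter_add_sdiff (μ := volume) A hb
    have h5 := measure_inter_add_sdiff (μ := volume) (Metric.ball 0 r) hA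
    rw [← h4, ← h5, inter_comm] at hAr
    have h6 : volume (Metric.ball 0 r ∩ A) ≠ ∞ :=
      ((measure_mono inter_subset_right).trans_lt hA'.measure_lt_top).ne
    exact (ENNReal.add_le_add_iff_left h6).1 hAr
  have hPsq : volume P ^ 2 ≠ ∞ := ENNReal.pow_ne_top hPf
  obtain ⟨h, hh⟩ : ∃ h : E, volume P ^ 2 / (2 * V) < volume (P ∩ (fun x => x + h) ⁻¹' Q) := by
    by_contra! hcon
    have hle : volume P * volume Q ≤ volume P ^ 2 / (2 * V) * V := by
      rw [← lintegral_volume_inter_preimage_add hPm hQm, hV,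
        ← lintegral_indicator_const Metric.isOpen_ball.measurableSet]
      refine lintegral_mono fun h => ?_
      by_cases hmem : h ∈ Metric.ball (0 : E) (2 * R)
      · rw [indicator_of_mem hmem]; exact hcon h
      · rw [indicator_of_notMem hmem]
        refine le_of_eq (measure_mono_null (t := ∅) ?_ (by simp))
        rintro x ⟨hx1, hx2⟩
        refine hmem ?_
        have n1 : ‖x‖ < R := by simpa using hAR hx1.1
        have n2 : ‖x + h‖ < r := by simpa using hx2.1
        have n3 : ‖h‖ ≤ ‖x + h‖ + ‖x‖ := by simpa using norm_sub_le (x + h) x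
        rw [mem_ball_zero_iff]
        linarith
    have hhalf : volume P ^ 2 / (2 * V) * V = volume P ^ 2 / 2 := by
      rw [div_eq_mul_inv, ENNReal.mul_inv (by simp) (by simp), mul_assoc, mul_assoc,
        ENNReal.inv_mul_cancel hV0 hVf, mul_one, div_eq_mul_inv]
    rw [hhalf] at hle
    have h1 : volume P ^ 2 ≤ volume P ^ 2 / 2 := by
      refine le_trans ?_ hle
      rw [sq]
      gcongr
    exact absurd h1 (not_le.2 (ENNReal.half_lt_self (pow_ne_zero 2 h0) hPsq))
  have hne : h ≠ 0 := by
    rintro rfl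
    have : P ∩ (fun x => x + 0) ⁻¹' Q = ∅ := by
      ext x
      simp only [mem_inter_iff, mem_preimage, add_zero, hP, hQ, mem_sdiff, mem_empty_iff_false]
      tauto
    rw [this] at hh
    simp at hh
  have hne' : ‖h‖ ≠ 0 := norm_ne_zero_iff.2 hne
  refine ⟨‖h‖⁻¹ • h, by rw [norm_smul, norm_inv, norm_norm, inv_mul_cancel₀ hne'], ?_⟩
  have key := volume_steiner_sdiff_ball_add_le (u := ‖h‖⁻¹ • h)
    (by rw [norm_smul, norm_inv, norm_norm, inv_mul_cancel₀ hne']) hA hA' r ‖h‖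
  rw [smul_smul, mul_inv_cancel₀ hne', one_smul] at key
  exact (by gcongr : _ ≤ _).trans key

theorem sumTriple_le_add_left (A B C a : Set E) :
    sumTriple A B C ≤ sumTriple a B C + volume (A \ a) * volume B := by
  rw [← Measure.prod_prod]
  refine le_trans (measure_mono ?_) (measure_union_le _ _)
  rintro q ⟨h1, h2, h3⟩
  by_cases h : q.1 ∈ a
  · exact Or.inl ⟨h, h2, h3⟩
  · exact Or.inr ⟨⟨h1, h⟩, h2⟩

theorem sumTriple_le_add_mid (A B C b : Set E) :
    sumTriple A B C ≤ sumTriple A b C + volume (B \ b) * volume A := by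
  rw [sumTriple_comm A B, sumTriple_comm A b]
  exact sumTriple_le_add_left B A C b

theorem sumTriple_le_add_right {A C c : Set E} (hA : MeasurableSet A) (hC : MeasurableSet C)
    (hc : MeasurableSet c) (B : Set E) :
    sumTriple A B C ≤ sumTriple A B c + volume (C \ c) * volume A := by
  have hshear := measurePreserving_prod_add (volume : Measure E) (volume : Measure E)
  rw [mul_comm, ← Measure.prod_prod, ← hshear.measure_preimage
    (hA.prod (hC.diff hc)).nullMeasurableSet]
  refine le_trans (measure_mono ?_) (measure_union_le _ _)
  rintro q ⟨h1, h2, h3⟩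
  by_cases h : q.1 + q.2 ∈ c
  · exact Or.inl ⟨h1, h2, h⟩
  · exact Or.inr ⟨h1, h3, h⟩

/-- Triples of measurable subsets of the ball of radius `R`, not larger than the balls of radii `a`,
`b`, `c`, whose Riesz functional is at least `I`. The class is stable under Steiner
symmetrization. -/
structure IsRieszAdmissible (R a b c : ℝ) (I : ℝ≥0∞) (A B C : Set E) : Prop where
  meas₁ : MeasurableSet A
  meas₂ : MeasurableSet B
  meas₃ : MeasurableSet C
  subset₁ : A ⊆ Metric.ball 0 R
  subset₂ : B ⊆ Metric.ball 0 R
  subset₃ : C ⊆ Metric.ball 0 R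
  volume₁ : volume A ≤ volume (Metric.ball (0 : E) a)
  volume₂ : volume B ≤ volume (Metric.ball (0 : E) b)
  volume₃ : volume C ≤ volume (Metric.ball (0 : E) c)
  le_sumTriple : I ≤ sumTriple A B C

theorem IsRieszAdmissible.steiner {R a b c : ℝ} {I : ℝ≥0∞} {A B C : Set E}
    (h : IsRieszAdmissible R a b c I A B C) {u : E} (hu : ‖u‖ = 1) :
    IsRieszAdmissible R a b c I (steiner u A) (steiner u B) (steiner u C) where
  meas₁ := measurableSet_steiner u h.meas₁
  meas₂ := measurableSet_steiner u h.meas₂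
  meas₃ := measurableSet_steiner u h.meas₃
  subset₁ := steiner_subset_ball hu h.subset₁
  subset₂ := steiner_subset_ball hu h.subset₂
  subset₃ := steiner_subset_ball hu h.subset₃
  volume₁ := (volume_steiner hu h.meas₁).trans_le h.volume₁
  volume₂ := (volume_steiner hu h.meas₂).trans_le h.volume₂
  volume₃ := (volume_steiner hu h.meas₃).trans_le h.volume₃
  le_sumTriple := h.le_sumTriple.trans (sumTriple_le_steiner hu h.meas₁ h.meas₂ h.meas₃
    (Metric.isBounded_ball.subset h.subset₁) (Metric.isBounded_ball.subset h.subset₂)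
    (Metric.isBounded_ball.subset h.subset₃))

/-- The total measure of three sets outside the centred balls of radii `a`, `b`, `c`. -/
def ballDefect (a b c : ℝ) (A B C : Set E) : ℝ≥0∞ :=
  volume (A \ Metric.ball 0 a) + volume (B \ Metric.ball 0 b) + volume (C \ Metric.ball 0 c)

/-- One of the three sets carries at least a third of the total defect; symmetrize in a direction
favourable to it. The defects of the other two do not increase. -/
theorem IsRieszAdmissible.exists_ballDefect_add_le {R a b c : ℝ} {I : ℝ≥0∞} {A B C : Set E}
    (h : IsRieszAdmissible R a b c I A B C) (ha : a ≤ R) (hb : b ≤ R) (hc : c ≤ R)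
    {m : ℝ≥0∞} (hm0 : m ≠ 0) (hm : m ≤ ballDefect a b c A B C) :
    ∃ u : E, ‖u‖ = 1 ∧ ballDefect a b c (AnisotropicModulus.steiner u A)
      (AnisotropicModulus.steiner u B) (AnisotropicModulus.steiner u C) +
      (m / 3) ^ 2 / (2 * volume (Metric.ball (0 : E) (2 * R))) ≤ ballDefect a b c A B C := by
  have hA' := Metric.isBounded_ball.subset h.subset₁
  have hB' := Metric.isBounded_ball.subset h.subset₂
  have hC' := Metric.isBounded_ball.subset h.subset₃
  have hm3 : m / 3 ≠ 0 := (ENNReal.div_pos hm0 (by simp)).ne'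
  have hcases : m / 3 ≤ volume (A \ Metric.ball 0 a) ∨ m / 3 ≤ volume (B \ Metric.ball 0 b) ∨
      m / 3 ≤ volume (C \ Metric.ball 0 c) := by
    by_contra! hlt
    have h1 := ENNReal.add_lt_add (ENNReal.add_lt_add hlt.1 hlt.2.1) hlt.2.2
    rw [ENNReal.add_thirds] at h1
    exact absurd hm (not_le.2 h1)
  rcases hcases with hx | hx | hx
  · obtain ⟨u, hu, hgain⟩ := exists_volume_steiner_sdiff_ball_add_le h.meas₁ h.subset₁ ha h.volume₁
      (ne_bot_of_le_ne_bot hm3 hx)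
    refine ⟨u, hu, ?_⟩
    have h2 := volume_steiner_sdiff_ball_le hu h.meas₂ hB' b
    have h3 := volume_steiner_sdiff_ball_le hu h.meas₃ hC' c
    have h1 := (add_le_add_right (ENNReal.div_le_div_right (pow_le_pow_left' hx 2) _) _).trans hgain
    refine le_trans (le_of_eq ?_) (add_le_add (add_le_add h1 h2) h3)
    rw [ballDefect]; ring
  · obtain ⟨u, hu, hgain⟩ := exists_volume_steiner_sdiff_ball_add_le h.meas₂ h.subset₂ hb h.volume₂
      (ne_bot_of_le_ne_bot hm3 hx)
    refine ⟨u, hu, ?_⟩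
    have h2 := volume_steiner_sdiff_ball_le hu h.meas₁ hA' a
    have h3 := volume_steiner_sdiff_ball_le hu h.meas₃ hC' c
    have h1 := (add_le_add_right (ENNReal.div_le_div_right (pow_le_pow_left' hx 2) _) _).trans hgain
    refine le_trans (le_of_eq ?_) (add_le_add (add_le_add h2 h1) h3)
    rw [ballDefect]; ring
  · obtain ⟨u, hu, hgain⟩ := exists_volume_steiner_sdiff_ball_add_le h.meas₃ h.subset₃ hc h.volume₃
      (ne_bot_of_le_ne_bot hm3 hx)
    refine ⟨u, hu, ?_⟩
    have h2 := volume_steiner_sdiff_ball_le hu h.meas₁ hA' a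
    have h3 := volume_steiner_sdiff_ball_le hu h.meas₂ hB' b
    have h1 := (add_le_add_right (ENNReal.div_le_div_right (pow_le_pow_left' hx 2) _) _).trans hgain
    refine le_trans (le_of_eq ?_) (add_le_add (add_le_add h2 h3) h1)
    rw [ballDefect]; ring

/-- The Riesz functional of an admissible triple exceeds that of the balls at most by a multiple
of the defect. -/
theorem IsRieszAdmissible.le_add_ballDefect_mul {R a b c : ℝ} {I : ℝ≥0∞} {A B C : Set E}
    (h : IsRieszAdmissible R a b c I A B C) :
    I ≤ sumTriple (Metric.ball (0 : E) a) (Metric.ball 0 b) (Metric.ball 0 c) +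
      ballDefect a b c A B C *
        (volume (Metric.ball (0 : E) a) + volume (Metric.ball (0 : E) b)) := by
  have hb : ∀ r, MeasurableSet (Metric.ball (0 : E) r) := fun r =>
    Metric.isOpen_ball.measurableSet
  have h1 := sumTriple_le_add_left A B C (Metric.ball 0 a)
  have h2 := sumTriple_le_add_mid (Metric.ball 0 a) B C (Metric.ball 0 b)
  have h3 := sumTriple_le_add_right (hb a) h.meas₃ (hb c) (Metric.ball 0 b)
  calc I ≤ _ := h.le_sumTriple.trans h1
    _ ≤ _ := add_le_add_left (h2.trans (add_le_add_left h3 _)) _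
    _ ≤ sumTriple (Metric.ball (0 : E) a) (Metric.ball 0 b) (Metric.ball 0 c) +
        volume (C \ Metric.ball 0 c) *
          (volume (Metric.ball (0 : E) a) + volume (Metric.ball (0 : E) b)) +
        volume (B \ Metric.ball 0 b) *
          (volume (Metric.ball (0 : E) a) + volume (Metric.ball (0 : E) b)) +
        volume (A \ Metric.ball 0 a) *
          (volume (Metric.ball (0 : E) a) + volume (Metric.ball (0 : E) b)) := by
        gcongr
        · exact le_self_add
        · exact le_self_add
        · exact h.volume₂.trans le_add_self
    _ = _ := by rw [ballDefect]; ring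

theorem sumTriple_le_ball_of_subset {R a b c : ℝ} {A B C : Set E}
    (hA : MeasurableSet A) (hB : MeasurableSet B) (hC : MeasurableSet C)
    (hAR : A ⊆ Metric.ball 0 R) (hBR : B ⊆ Metric.ball 0 R) (hCR : C ⊆ Metric.ball 0 R)
    (hAa : volume A ≤ volume (Metric.ball (0 : E) a))
    (hBb : volume B ≤ volume (Metric.ball (0 : E) b))
    (hCc : volume C ≤ volume (Metric.ball (0 : E) c)) (ha : a ≤ R) (hb : b ≤ R) (hc : c ≤ R) :
    sumTriple A B C ≤ sumTriple (Metric.ball (0 : E) a) (Metric.ball 0 b) (Metric.ball 0 c) := by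
  set T : Set ℝ≥0∞ := {d | ∃ A' B' C' : Set E,
    IsRieszAdmissible R a b c (sumTriple A B C) A' B' C' ∧ d = ballDefect a b c A' B' C'}
  have hbase : IsRieszAdmissible R a b c (sumTriple A B C) A B C :=
    ⟨hA, hB, hC, hAR, hBR, hCR, hAa, hBb, hCc, le_rfl⟩
  -- Near a positive infimum, one more symmetrization would go below it.
  have hinf : sInf T = 0 := by
    by_contra hm
    set m := sInf T
    have hfin : m ≠ ∞ := by
      refine ((sInf_le ⟨A, B, C, hbase, rfl⟩ : m ≤ _).trans_lt ?_).ne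
      have hf : ∀ {S : Set E} (r : ℝ), S ⊆ Metric.ball 0 R → volume (S \ Metric.ball 0 r) < ∞ :=
        fun r hS => (measure_mono (sdiff_subset.trans hS)).trans_lt measure_ball_lt_top
      exact ENNReal.add_lt_top.2 ⟨ENNReal.add_lt_top.2 ⟨hf a hAR, hf b hBR⟩, hf c hCR⟩
    set η := (m / 3) ^ 2 / (2 * volume (Metric.ball (0 : E) (2 * R)))
    have hη0 : η ≠ 0 := (ENNReal.div_pos (pow_ne_zero 2 (ENNReal.div_pos hm (by simp)).ne')
      (ENNReal.mul_ne_top (by simp) measure_ball_lt_top.ne)).ne'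
    obtain ⟨d, ⟨A', B', C', hadm, rfl⟩, hd⟩ := sInf_lt_iff.1 (ENNReal.lt_add_right hfin hη0)
    obtain ⟨u, hu, hgain⟩ := hadm.exists_ballDefect_add_le ha hb hc hm
      (sInf_le ⟨A', B', C', hadm, rfl⟩)
    have hlt := hgain.trans_lt hd
    have hlt' := lt_of_add_lt_add_right hlt
    have hmem : ballDefect a b c (steiner u A') (steiner u B') (steiner u C') ∈ T :=
      ⟨_, _, _, hadm.steiner hu, rfl⟩
    exact absurd (sInf_le hmem) (not_le.2 hlt')
  set M := volume (Metric.ball (0 : E) a) + volume (Metric.ball (0 : E) b) with hM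
  have hMf : M ≠ ∞ := ENNReal.add_ne_top.2 ⟨measure_ball_lt_top.ne, measure_ball_lt_top.ne⟩
  refine ENNReal.le_of_forall_pos_le_add fun ε hε _ => ?_
  have hpos : 0 < (ε : ℝ≥0∞) / (M + 1) :=
    ENNReal.div_pos (by exact_mod_cast hε.ne') (ENNReal.add_ne_top.2 ⟨hMf, by simp⟩)
  rw [← hinf] at hpos
  obtain ⟨d, ⟨A', B', C', hadm, rfl⟩, hd⟩ := sInf_lt_iff.1 hpos
  refine hadm.le_add_ballDefect_mul.trans ?_
  rw [← hM]
  gcongr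
  calc _ ≤ (ε : ℝ≥0∞) / (M + 1) * (M + 1) := by gcongr; exact le_self_add
    _ = ε := ENNReal.div_mul_cancel (by simp) (ENNReal.add_ne_top.2 ⟨hMf, by simp⟩)

/-- Riesz's rearrangement inequality for three measurable sets in a Euclidean space. -/
theorem sumTriple_le_ball {a b c : ℝ} {A B C : Set E}
    (hA : MeasurableSet A) (hB : MeasurableSet B) (hC : MeasurableSet C)
    (hAa : volume A ≤ volume (Metric.ball (0 : E) a))
    (hBb : volume B ≤ volume (Metric.ball (0 : E) b))
    (hCc : volume C ≤ volume (Metric.ball (0 : E) c)) :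
    sumTriple A B C ≤ sumTriple (Metric.ball (0 : E) a) (Metric.ball 0 b) (Metric.ball 0 c) := by
  set S : ℕ → Set (E × E) := fun k => {q : E × E | q.1 ∈ A ∩ Metric.ball 0 (k : ℝ) ∧
    q.2 ∈ B ∩ Metric.ball 0 (k : ℝ) ∧ q.1 + q.2 ∈ C ∩ Metric.ball 0 (k : ℝ)} with hS
  have hmono : Monotone S := by
    intro j k hjk q hq
    have hsub : Metric.ball (0 : E) (j : ℝ) ⊆ Metric.ball 0 (k : ℝ) :=
      Metric.ball_subset_ball (by exact_mod_cast hjk)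
    exact ⟨⟨hq.1.1, hsub hq.1.2⟩, ⟨hq.2.1.1, hsub hq.2.1.2⟩, ⟨hq.2.2.1, hsub hq.2.2.2⟩⟩
  have hunion : {q : E × E | q.1 ∈ A ∧ q.2 ∈ B ∧ q.1 + q.2 ∈ C} = ⋃ k, S k := by
    ext q
    simp only [hS, mem_iUnion, mem_ofPred_eq, mem_inter_iff, mem_ball_zero_iff]
    constructor
    · rintro ⟨h1, h2, h3⟩
      obtain ⟨k, hk⟩ := exists_nat_gt (max ‖q.1‖ (max ‖q.2‖ ‖q.1 + q.2‖))
      simp only [max_lt_iff] at hk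
      exact ⟨k, ⟨h1, hk.1⟩, ⟨h2, hk.2.1⟩, h3, hk.2.2⟩
    · rintro ⟨k, h1, h2, h3⟩
      exact ⟨h1.1, h2.1, h3.1⟩
  rw [sumTriple, hunion, hmono.measure_iUnion]
  refine iSup_le fun k => ?_
  have hb : MeasurableSet (Metric.ball (0 : E) (k : ℝ)) := Metric.isOpen_ball.measurableSet
  have hsub : ∀ S : Set E, S ∩ Metric.ball 0 (k : ℝ) ⊆
      Metric.ball 0 (max (k : ℝ) (max a (max b c))) := fun S =>
    inter_subset_right.trans (Metric.ball_subset_ball (le_max_left _ _))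
  have hle : ∀ {S T : Set E}, volume S ≤ volume T →
      volume (S ∩ Metric.ball 0 (k : ℝ)) ≤ volume T := fun h =>
    (measure_mono inter_subset_left).trans h
  exact sumTriple_le_ball_of_subset (hA.inter hb) (hB.inter hb) (hC.inter hb) (hsub A) (hsub B)
    (hsub C) (hle hAa) (hle hBb) (hle hCc) (by simp) (by simp) (by simp)

/-! ### Rearrangement of the translation energy -/

/-- For `σ = (s, v)` with `v > 0`, the set of `y ≥ s` with `v ≤ p (y - s)^(p - 1)`. These sets
give a layer-cake formula for the positive part of the `p`-th power of a difference
(`volume_layer`). The condition `s ≤ y` keeps the base of the power nonnegative; for `p = 1` the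
power is `1`, also at `y = s`. -/
def layer (p : ℝ) (σ : ℝ × ℝ) : Set ℝ := {y | σ.1 ≤ y ∧ 0 < σ.2 ∧ σ.2 ≤ p * (y - σ.1) ^ (p - 1)}

theorem layer_eq_empty_or_Ici {p : ℝ} (hp : 1 ≤ p) (σ : ℝ × ℝ) :
    layer p σ = ∅ ∨ ∃ c, σ.1 ≤ c ∧ layer p σ = Ici c := by
  rcases le_or_gt σ.2 0 with hv | hv
  · left; ext y; simp [layer, not_lt.2 hv]
  rcases hp.eq_or_lt with rfl | hp1
  · by_cases h1 : σ.2 ≤ 1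
    · right
      refine ⟨σ.1, le_rfl, ?_⟩
      ext y
      simp [layer, hv, h1]
    · left; ext y; simp [layer, h1]
  · right
    have hp0 : 0 < p := by linarith
    refine ⟨σ.1 + (σ.2 / p) ^ (p - 1)⁻¹, by simp; positivity, ?_⟩
    ext y
    simp only [layer, mem_ofPred_eq, mem_Ici, hv, true_and]
    constructor
    · rintro ⟨h1, h2⟩
      have : σ.2 / p ≤ (y - σ.1) ^ (p - 1) := by rwa [div_le_iff₀' hp0]
      have := (Real.rpow_inv_le_iff_of_pos (by positivity) (by linarith) (by linarith)).2 this
      linarith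
    · intro h
      have h0 : 0 ≤ (σ.2 / p) ^ (p - 1)⁻¹ := by positivity
      have h1 : σ.1 ≤ y := by linarith
      refine ⟨h1, ?_⟩
      have := (Real.rpow_inv_le_iff_of_pos (by positivity) (by linarith) (by linarith)).1
        (show (σ.2 / p) ^ (p - 1)⁻¹ ≤ y - σ.1 by linarith)
      rwa [div_le_iff₀' hp0] at this

theorem measurableSet_layer_prod (p : ℝ) {X : Type*} [MeasurableSpace X] {f g : X → ℝ}
    (hf : Measurable f) (hg : Measurable g) :
    MeasurableSet {z : X × (ℝ × ℝ) | f z.1 < z.2.1 ∧ g z.1 ∈ layer p z.2} := by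
  have hf' : Measurable fun z : X × (ℝ × ℝ) => f z.1 := hf.comp measurable_fst
  have hg' : Measurable fun z : X × (ℝ × ℝ) => g z.1 := hg.comp measurable_fst
  have h1 : Measurable fun z : X × (ℝ × ℝ) => z.2.1 := by fun_prop
  have h2 : Measurable fun z : X × (ℝ × ℝ) => z.2.2 := by fun_prop
  exact (measurableSet_lt hf' h1).inter ((measurableSet_le h1 hg').inter
    ((measurableSet_lt measurable_const h2).inter
      (measurableSet_le h2 (((hg'.sub h1).pow_const _).const_mul p))))

/-- Layer-cake formula for `(a - b)₊ ^ p`: integrate `p (a - s)^(p - 1)` over `b < s ≤ a`. -/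
theorem volume_layer {p : ℝ} (hp : 1 ≤ p) (a b : ℝ) :
    volume {σ : ℝ × ℝ | b < σ.1 ∧ a ∈ layer p σ} = ENNReal.ofReal (max (a - b) 0 ^ p) := by
  have hm : MeasurableSet {σ : ℝ × ℝ | b < σ.1 ∧ a ∈ layer p σ} :=
    measurable_prodMk_left (x := ()) (measurableSet_layer_prod p (X := Unit)
      (measurable_const (a := b)) (measurable_const (a := a)))
  rw [Measure.volume_eq_prod, Measure.prod_apply hm]
  have hsec : ∀ s : ℝ, volume (Prod.mk s ⁻¹' {σ : ℝ × ℝ | b < σ.1 ∧ a ∈ layer p σ}) =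
      (Ioc b a).indicator (fun s => ENNReal.ofReal (p * (a - s) ^ (p - 1))) s := by
    intro s
    by_cases hs : s ∈ Ioc b a
    · rw [indicator_of_mem hs]
      have : Prod.mk s ⁻¹' {σ : ℝ × ℝ | b < σ.1 ∧ a ∈ layer p σ} =
          Ioc 0 (p * (a - s) ^ (p - 1)) := by
        ext v
        simp [layer, hs.1, hs.2]
      rw [this, Real.volume_Ioc, sub_zero]
    · rw [indicator_of_notMem hs]
      refine measure_mono_null (t := ∅) ?_ (by simp)
      rintro v ⟨h1, h2⟩
      exact hs ⟨h1, h2.1⟩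
  simp only [hsec]
  rw [lintegral_indicator measurableSet_Ioc]
  rcases le_total b a with h | h
  · rw [max_eq_left (by linarith)]
    have hcont : Continuous fun s : ℝ => p * (a - s) ^ (p - 1) :=
      continuous_const.mul ((continuous_const.sub continuous_id).rpow_const
        fun _ => Or.inr (by linarith))
    rw [← ofReal_integral_eq_lintegral_ofReal, ← intervalIntegral.integral_of_le h]
    · congr 1
      rw [intervalIntegral.integral_comp_sub_left (fun u => p * u ^ (p - 1)),
        intervalIntegral.integral_const_mul, integral_rpow (Or.inl (by linarith))]
      rw [sub_self, sub_add_cancel, Real.zero_rpow (by linarith), sub_zero]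
      field_simp
    · exact hcont.integrableOn_Icc.mono_set Ioc_subset_Icc_self
    · refine (ae_restrict_iff' measurableSet_Ioc).2 (.of_forall fun s hs => ?_)
      have : 0 ≤ a - s := by linarith [hs.2]
      simp only [Pi.zero_apply]
      positivity
  · rw [max_eq_right (by linarith), Ioc_eq_empty (by simpa using h), Real.zero_rpow (by linarith)]
    simp

theorem ofReal_abs_sub_rpow {p : ℝ} (hp : 1 ≤ p) (a b : ℝ) :
    ENNReal.ofReal (|a - b| ^ p) =
      ENNReal.ofReal (max (a - b) 0 ^ p) + ENNReal.ofReal (max (b - a) 0 ^ p) := by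
  rcases le_total b a with h | h
  · rw [abs_of_nonneg (by linarith), max_eq_left (by linarith), max_eq_right (a := b - a)
      (by linarith), Real.zero_rpow (by linarith)]
    simp
  · rw [abs_of_nonpos (by linarith), max_eq_right (by linarith), max_eq_left (a := b - a)
      (by linarith), Real.zero_rpow (by linarith)]
    simp

/-- The layer-cake formula turns the energy of `f` into a superposition of Riesz functionals, each
involving one sublevel set and one superlevel set of `f`. -/
theorem lintegral_posPart_eq_lintegral_sumTriple {p : ℝ} (hp : 1 ≤ p) {W : Set E}
    (hW : MeasurableSet W) {f : E → ℝ} (hf : Measurable f) :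
    ∫⁻ h in W, ∫⁻ x, ENNReal.ofReal (max (f (h + x) - f x) 0 ^ p) =
      ∫⁻ σ : ℝ × ℝ, sumTriple W (f ⁻¹' Iio σ.1) (f ⁻¹' layer p σ) := by
  have hadd : Measurable fun q : E × E => f (q.1 + q.2) := hf.comp measurable_add
  have hM := measurableSet_layer_prod p (hf.comp (measurable_snd (α := E))) hadd
  set M := {z : (E × E) × (ℝ × ℝ) | f z.1.2 < z.2.1 ∧ f (z.1.1 + z.1.2) ∈ layer p z.2} with hMdef
  set N := M ∩ {z | z.1.1 ∈ W} with hN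
  have hNm : MeasurableSet N := hM.inter (hW.preimage (by fun_prop))
  calc ∫⁻ h in W, ∫⁻ x, ENNReal.ofReal (max (f (h + x) - f x) 0 ^ p)
      = ∫⁻ h, ∫⁻ x, volume (Prod.mk (h, x) ⁻¹' N) := by
        rw [← lintegral_indicator hW]
        refine lintegral_congr fun h => ?_
        by_cases hh : h ∈ W
        · rw [indicator_of_mem hh]
          refine lintegral_congr fun x => ?_
          rw [← volume_layer hp]
          congr 1
          ext σ
          simp [hN, hMdef, hh]
        · rw [indicator_of_notMem hh]
          have : ∀ x, Prod.mk (h, x) ⁻¹' N = ∅ := fun x => by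
            ext σ; simp [hN, hh]
          simp [this]
    _ = ∫⁻ q : E × E, volume (Prod.mk q ⁻¹' N) := by
        rw [Measure.volume_eq_prod E E,
          lintegral_prod _ (measurable_measure_prodMk_left hNm).aemeasurable]
    _ = ∫⁻ σ : ℝ × ℝ, volume ((fun q : E × E => (q, σ)) ⁻¹' N) := by
        rw [← Measure.prod_apply hNm, ← Measure.prod_apply_symm hNm]
    _ = _ := by
        refine lintegral_congr fun σ => ?_
        rw [sumTriple]
        congr 1
        ext q
        simp only [hN, hMdef, mem_preimage, mem_inter_iff, mem_ofPred_eq, mem_Iio]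
        tauto

/-- The substitution `(h, x) ↦ (-h, x + h)` turns the negative parts of the differences into the
positive parts for `-W`. -/
theorem lintegral_abs_sub_eq_add {p : ℝ} (hp : 1 ≤ p) {W : Set E}
    (hW : MeasurableSet W) {f : E → ℝ} (hf : Measurable f) :
    ∫⁻ h in W, ∫⁻ x, ENNReal.ofReal (|f (x + h) - f x| ^ p) =
      (∫⁻ h in W, ∫⁻ x, ENNReal.ofReal (max (f (h + x) - f x) 0 ^ p)) +
        ∫⁻ h in -W, ∫⁻ x, ENNReal.ofReal (max (f (h + x) - f x) 0 ^ p) := by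
  have hadd : Measurable fun q : E × E => f (q.1 + q.2) := hf.comp measurable_add
  have hFm : Measurable fun q : E × E => ENNReal.ofReal (max (f (q.1 + q.2) - f q.2) 0 ^ p) :=
    (((hadd.sub (hf.comp measurable_snd)).max measurable_const).pow_const p).ennreal_ofReal
  have hneg : ∫⁻ h in -W, ∫⁻ x, ENNReal.ofReal (max (f (h + x) - f x) 0 ^ p) =
      ∫⁻ h in W, ∫⁻ x, ENNReal.ofReal (max (f x - f (h + x)) 0 ^ p) := by
    rw [← lintegral_indicator hW.neg, ← lintegral_neg_eq_self, ← lintegral_indicator hW]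
    refine lintegral_congr fun h => ?_
    by_cases hh : h ∈ W
    · rw [indicator_of_mem hh, indicator_of_mem (by simpa using hh),
        ← lintegral_add_left_eq_self _ h]
      simp
    · rw [indicator_of_notMem hh, indicator_of_notMem (by simpa using hh)]
  rw [hneg, ← lintegral_add_left hFm.lintegral_prod_right']
  refine lintegral_congr fun h => ?_
  refine Eq.trans ?_ (lintegral_add_left (hFm.comp measurable_prodMk_left) _)
  refine lintegral_congr fun x => ?_
  simp only [Function.comp_apply]
  rw [add_comm x h, ofReal_abs_sub_rpow hp]

theorem sumTriple_compl_add {W A B : Set E} (hW : MeasurableSet W) (hA : MeasurableSet A)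
    (hB : MeasurableSet B) :
    sumTriple W Bᶜ A + sumTriple W B A = volume W * volume A := by
  have hshear := measurePreserving_prod_add (volume : Measure E) (volume : Measure E)
  rw [← Measure.prod_prod, ← hshear.measure_preimage (hW.prod hA).nullMeasurableSet, add_comm,
    ← measure_inter_add_sdiff _ (measurable_snd (α := E) hB)]
  congr 1
  · rw [sumTriple]
    congr 1
    ext q; simp only [mem_ofPred_eq, mem_inter_iff, mem_preimage, mem_prod]; tauto
  · rw [sumTriple]
    congr 1
    ext q; simp only [mem_ofPred_eq, mem_sdiff, mem_preimage, mem_prod, mem_compl_iff]; tauto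

/-- `g` is a symmetric decreasing rearrangement of `f` at positive heights: up to null sets, each
superlevel set `{g ≥ c}` with `c > 0` is a centred ball of the measure of `{f ≥ c}`, which is
thereby finite. -/
def IsSymmDecreasingRearr (f g : E → ℝ) : Prop :=
  ∀ c, 0 < c → ∃ r, volume (f ⁻¹' Ici c) = volume (Metric.ball (0 : E) r) ∧
    g ⁻¹' Ici c =ᵐ[volume] Metric.ball (0 : E) r

/-- With a sublevel set in the middle the inequality of Riesz is reversed, since passing to the
complement subtracts the functional from the fixed quantity `|W| |{f ≥ c}|`. -/
theorem IsSymmDecreasingRearr.sumTriple_le {f g : E → ℝ} (hfg : IsSymmDecreasingRearr f g)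
    (hf : Measurable f) (hg : Measurable g) {W : Set E} (hW : MeasurableSet W) {R : ℝ}
    (hWR : volume W = volume (Metric.ball (0 : E) R)) {s c : ℝ} (hs : 0 < s) (hc : 0 < c) :
    sumTriple (Metric.ball 0 R) (g ⁻¹' Iio s) (g ⁻¹' Ici c) ≤
      sumTriple W (f ⁻¹' Iio s) (f ⁻¹' Ici c) := by
  obtain ⟨r, hr, hr'⟩ := hfg c hc
  obtain ⟨d, hd, hd'⟩ := hfg s hs
  have hb : MeasurableSet (Metric.ball (0 : E) R) := Metric.isOpen_ball.measurableSet
  have hfc : MeasurableSet (f ⁻¹' Ici c) := hf measurableSet_Ici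
  have hfs : MeasurableSet (f ⁻¹' Ici s) := hf measurableSet_Ici
  have hgc : MeasurableSet (g ⁻¹' Ici c) := hg measurableSet_Ici
  have hgs : MeasurableSet (g ⁻¹' Ici s) := hg measurableSet_Ici
  have key : sumTriple W (f ⁻¹' Ici s) (f ⁻¹' Ici c) ≤
      sumTriple (Metric.ball 0 R) (g ⁻¹' Ici s) (g ⁻¹' Ici c) := by
    have hnull : ∀ {S T : Set E}, S =ᵐ[volume] T → volume (T \ S) = 0 := fun h =>
      ae_le_set.1 h.symm.le
    refine (sumTriple_le_ball hW hfs hfc hWR.le hd.le hr.le).trans ?_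
    refine (sumTriple_le_add_mid _ _ _ (g ⁻¹' Ici s)).trans ?_
    rw [hnull hd', zero_mul, add_zero]
    refine (sumTriple_le_add_right hb Metric.isOpen_ball.measurableSet hgc _).trans ?_
    rw [hnull hr', zero_mul, add_zero]
  have e1 := sumTriple_compl_add hW hfc hfs
  have e2 := sumTriple_compl_add hb hgc hgs
  rw [measure_congr hr', ← hr, ← hWR, ← e1] at e2
  have hcompl : ∀ k : E → ℝ, (k ⁻¹' Ici s)ᶜ = k ⁻¹' Iio s := fun k => by
    rw [← preimage_compl, compl_Ici]
  rw [hcompl, hcompl] at e2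
  have hfin : sumTriple W (f ⁻¹' Ici s) (f ⁻¹' Ici c) ≠ ∞ := by
    refine ((le_add_self.trans e1.le).trans_lt ?_).ne
    rw [hWR, hr]
    exact ENNReal.mul_lt_top measure_ball_lt_top measure_ball_lt_top
  refine (ENNReal.add_le_add_iff_right hfin).1 (le_trans ?_ e2.le)
  gcongr

/-- Rearranging `f` and `W` does not increase `∫_W ‖f(· + h) - f‖_p^p dh`. -/
theorem IsSymmDecreasingRearr.lintegral_abs_sub_le {f g : E → ℝ} (hfg : IsSymmDecreasingRearr f g)
    (hf : Measurable f) (hg : Measurable g) (hg0 : ∀ x, 0 ≤ g x)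
    {W : Set E} (hW : MeasurableSet W) {R : ℝ}
    (hWR : volume W = volume (Metric.ball (0 : E) R)) {p : ℝ} (hp : 1 ≤ p) :
    ∫⁻ h in Metric.ball (0 : E) R, ∫⁻ x, ENNReal.ofReal (|g (x + h) - g x| ^ p) ≤
      ∫⁻ h in W, ∫⁻ x, ENNReal.ofReal (|f (x + h) - f x| ^ p) := by
  have hb : MeasurableSet (Metric.ball (0 : E) R) := Metric.isOpen_ball.measurableSet
  have key : ∀ {W : Set E}, MeasurableSet W → volume W = volume (Metric.ball (0 : E) R) →
      ∫⁻ h in Metric.ball (0 : E) R, ∫⁻ x, ENNReal.ofReal (max (g (h + x) - g x) 0 ^ p) ≤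
        ∫⁻ h in W, ∫⁻ x, ENNReal.ofReal (max (f (h + x) - f x) 0 ^ p) := by
    intro W hW hWR
    rw [lintegral_posPart_eq_lintegral_sumTriple hp hW hf,
      lintegral_posPart_eq_lintegral_sumTriple hp hb hg]
    refine lintegral_mono fun σ => ?_
    rcases le_or_gt σ.1 0 with hs | hs
    · have : g ⁻¹' Iio σ.1 = ∅ := by
        ext x; simpa using hs.trans (hg0 x)
      simp [this, sumTriple]
    · rcases layer_eq_empty_or_Ici hp σ with h | ⟨c, hc, h⟩
      · simp [h, sumTriple]
      · rw [h]
        exact hfg.sumTriple_le hf hg hW hWR hs (hs.trans_le hc)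
  rw [lintegral_abs_sub_eq_add hp hW hf, lintegral_abs_sub_eq_add hp hb hg]
  refine add_le_add (key hW hWR) ?_
  have hsymm : -Metric.ball (0 : E) R = Metric.ball 0 R := by ext; simp
  rw [hsymm]
  exact key hW.neg ((Measure.measure_neg _ _).trans hWR)

/-! ### Schwarz symmetrals and star bodies -/

variable {n : ℕ}

theorem exists_schwarzSet_eq_closedBall (hn : 1 ≤ n) {S : Set (EuclideanSpace ℝ (Fin n))}
    (h0 : volume S ≠ 0) (hS : volume S ≠ ∞) :
    ∃ r, 0 < r ∧ schwarzSet S = Metric.closedBall 0 r ∧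
      volume S = volume (Metric.closedBall (0 : EuclideanSpace ℝ (Fin n)) r) := by
  have hset : schwarzSet S = Metric.closedBall (0 : EuclideanSpace ℝ (Fin n))
      ((volume S / volume (Metric.closedBall (0 : EuclideanSpace ℝ (Fin n)) 1)).toReal
        ^ (1 / (n : ℝ))) := by
    ext x; simp [schwarzSet, h0]
  refine ⟨_, ?_, hset, by rw [← hset, volume_schwarzSet hn S hS]⟩
  refine Real.rpow_pos_of_pos (ENNReal.toReal_pos ?_ ?_) _
  · exact (ENNReal.div_pos h0 measure_closedBall_lt_top.ne).ne'
  · exact ENNReal.div_ne_top hS (Metric.measure_closedBall_pos volume _ one_pos).ne'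

theorem mem_schwarzSet_iff (hn : 1 ≤ n) {S : Set (EuclideanSpace ℝ (Fin n))}
    (hS : volume S ≠ ∞) {x : EuclideanSpace ℝ (Fin n)} (hx : x ≠ 0) :
    x ∈ schwarzSet S ↔
      volume (Metric.closedBall (0 : EuclideanSpace ℝ (Fin n)) ‖x‖) ≤ volume S := by
  by_cases h0 : volume S = 0
  · have : volume (Metric.closedBall (0 : EuclideanSpace ℝ (Fin n)) ‖x‖) ≠ 0 :=
      (Metric.measure_closedBall_pos volume _ (norm_pos_iff.2 hx)).ne'
    simpa [schwarzSet, h0] using this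
  obtain ⟨r, hr, hr1, hr2⟩ := exists_schwarzSet_eq_closedBall hn h0 hS
  have hB0 : volume (Metric.closedBall (0 : EuclideanSpace ℝ (Fin n)) 1) ≠ 0 :=
    (Metric.measure_closedBall_pos volume _ one_pos).ne'
  have hBt : volume (Metric.closedBall (0 : EuclideanSpace ℝ (Fin n)) 1) ≠ ⊤ :=
    measure_closedBall_lt_top.ne
  rw [hr1, hr2, mem_closedBall_zero_iff, Measure.addHaar_closedBall' volume _ hr.le,
    Measure.addHaar_closedBall' volume _ (norm_nonneg x),
    ENNReal.mul_le_mul_iff_left hB0 hBt, ENNReal.ofReal_le_ofReal_iff (by positivity),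
    finrank_euclideanSpace_fin, pow_le_pow_iff_left₀ (norm_nonneg x) hr.le (by omega)]

/-- Away from the origin the superlevel sets of `f^⋆` are the symmetrals of those of `|f|`. The
heights `t` with `x ∈ {|f| ≥ t}^⋆` form an interval `(0, τ]`, closed on the right because `t ↦
|{|f| ≥ t}|` is left-continuous, and `f^⋆ x` is its length `τ`. At the origin the integral
defining `f^⋆` may diverge, and its value there is then the junk value `0`. -/
theorem le_schwarzFun_iff (hn : 1 ≤ n) {f : EuclideanSpace ℝ (Fin n) → ℝ} (hf : Measurable f)
    (hfin : ∀ c, 0 < c → volume {y | c ≤ |f y|} ≠ ∞) {x : EuclideanSpace ℝ (Fin n)} (hx : x ≠ 0)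
    {c : ℝ} (hc : 0 < c) : c ≤ schwarzFun f x ↔ x ∈ schwarzSet {y | c ≤ |f y|} := by
  set v := volume (Metric.closedBall (0 : EuclideanSpace ℝ (Fin n)) ‖x‖)
  have hv0 : v ≠ 0 := (Metric.measure_closedBall_pos volume _ (norm_pos_iff.2 hx)).ne'
  have hmem : ∀ {t}, 0 < t → (x ∈ schwarzSet {y | t ≤ |f y|} ↔ v ≤ volume {y | t ≤ |f y|}) :=
    fun ht => mem_schwarzSet_iff hn (hfin _ ht) hx
  have hmeas : ∀ t, MeasurableSet {y | t ≤ |f y|} := fun t =>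
    measurableSet_le measurable_const hf.abs
  have hanti : ∀ {s t : ℝ}, s ≤ t → {y | t ≤ |f y|} ⊆ {y | s ≤ |f y|} := fun h y hy =>
    h.trans hy
  set T := {t : ℝ | 0 < t ∧ v ≤ volume {y | t ≤ |f y|}} with hT
  have hdown : ∀ {s t}, t ∈ T → 0 < s → s ≤ t → s ∈ T := fun ht hs hst =>
    ⟨hs, ht.2.trans (measure_mono (hanti hst))⟩
  -- Continuity from above of the measure along the superlevel sets.
  have hlim : ∀ t : ℕ → ℝ, Monotone t → (∀ k, t k ∈ T) → v ≤ volume (⋂ k, {y | t k ≤ |f y|}) := by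
    intro t ht htT
    rw [Antitone.measure_iInter (fun j k hjk => hanti (ht hjk))
      (fun k => (hmeas _).nullMeasurableSet) ⟨0, hfin _ (htT 0).1⟩]
    exact le_iInf fun k => (htT k).2
  have hbdd : BddAbove T := by
    by_contra hnb
    have hall : ∀ k : ℕ, (k + 1 : ℝ) ∈ T := fun k => by
      obtain ⟨t, ht, hkt⟩ := not_bddAbove_iff.1 hnb (k + 1)
      exact hdown ht (by positivity) hkt.le
    have h := hlim (fun k => (k + 1 : ℝ)) (fun j k hjk => by simpa using hjk) hall
    have : (⋂ k : ℕ, {y | (k + 1 : ℝ) ≤ |f y|}) = ∅ := by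
      ext y
      simp only [mem_iInter, mem_ofPred_eq, mem_empty_iff_false, iff_false, not_forall, not_le]
      obtain ⟨k, hk⟩ := exists_nat_gt |f y|
      exact ⟨k, by linarith⟩
    rw [this, measure_empty] at h
    exact hv0 (le_antisymm h (zero_le))
  rw [hmem hc]
  have hiff : v ≤ volume {y | c ≤ |f y|} ↔ c ∈ T := by simp [hT, hc]
  rw [hiff]
  rcases T.eq_empty_or_nonempty with hempty | hne
  · have : schwarzFun f x = 0 := by
      rw [schwarzFun, setIntegral_congr_fun (g := fun _ => (0 : ℝ)) measurableSet_Ioi]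
      · simp
      · intro t ht
        refine indicator_of_notMem (fun h => ?_) _
        have : t ∈ T := ⟨ht, (hmem ht).1 h⟩
        simp [hempty] at this
    rw [this, hempty]
    simp [hc]
  · set τ := sSup T
    have hτ0 : 0 < τ := by
      obtain ⟨t, ht⟩ := hne
      exact ht.1.trans_le (le_csSup hbdd ht)
    have hτT : τ ∈ T := by
      refine ⟨hτ0, ?_⟩
      have h := hlim (fun k : ℕ => τ - τ / (k + 2)) (fun j k hjk => by
          have : (j : ℝ) ≤ k := by exact_mod_cast hjk
          simp only
          gcongr) fun k => by
        have h1 : τ / (k + 2 : ℝ) < τ := div_lt_self hτ0 (by linarith [(k.cast_nonneg : (0:ℝ) ≤ k)])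
        have h2 : 0 < τ / (k + 2 : ℝ) := by positivity
        obtain ⟨t, ht, hlt⟩ := exists_lt_of_lt_csSup hne (show τ - τ / (k + 2) < sSup T by linarith)
        exact hdown ht (by linarith) hlt.le
      refine h.trans (measure_mono fun y hy => ?_)
      simp only [mem_iInter, mem_ofPred_eq] at hy ⊢
      have hlimit : Filter.Tendsto (fun k : ℕ => τ - τ / (k + 2 : ℝ)) Filter.atTop (nhds (τ - 0)) :=
        tendsto_const_nhds.sub (tendsto_const_nhds.div_atTop
          (Filter.tendsto_atTop_add_const_right _ _ tendsto_natCast_atTop_atTop))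
      rw [sub_zero] at hlimit
      exact le_of_tendsto' hlimit hy
    have hTeq : T = Ioc 0 τ := by
      ext t
      exact ⟨fun ht => ⟨ht.1, le_csSup hbdd ht⟩, fun ht => hdown hτT ht.1 ht.2⟩
    have : schwarzFun f x = τ := by
      rw [schwarzFun, setIntegral_congr_fun (g := (Ioc 0 τ).indicator fun _ => (1 : ℝ))
        measurableSet_Ioi]
      · rw [setIntegral_indicator measurableSet_Ioc, inter_eq_right.2 Ioc_subset_Ioi_self]
        simp [hτ0.le]
      · intro t ht
        have : x ∈ schwarzSet {y | t ≤ |f y|} ↔ t ∈ Ioc 0 τ := by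
          rw [hmem ht, ← hTeq]; simp [hT, show 0 < t from ht]
        by_cases h : t ∈ Ioc 0 τ
        · simp only [indicator_of_mem h, indicator_of_mem (this.2 h)]
        · simp only [indicator_of_notMem h, indicator_of_notMem (fun h' => h (this.1 h'))]
    rw [this, hTeq, mem_Ioc]
    exact ⟨fun h => ⟨hc, h⟩, And.right⟩

theorem schwarzFun_nonneg (f : EuclideanSpace ℝ (Fin n) → ℝ) (x : EuclideanSpace ℝ (Fin n)) :
    0 ≤ schwarzFun f x :=
  integral_nonneg fun _ => indicator_nonneg (fun _ _ => zero_le_one) _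

theorem measurableSet_schwarzSet (S : Set (EuclideanSpace ℝ (Fin n))) :
    MeasurableSet (schwarzSet S) :=
  (MeasurableSet.const _).inter Metric.isClosed_closedBall.measurableSet

theorem schwarzFun_preimage_Ici_sdiff (hn : 1 ≤ n) {f : EuclideanSpace ℝ (Fin n) → ℝ}
    (hf : Measurable f) (hfin : ∀ c, 0 < c → volume {y | c ≤ |f y|} ≠ ∞) {c : ℝ} (hc : 0 < c) :
    schwarzFun f ⁻¹' Ici c \ {0} = schwarzSet {y | c ≤ |f y|} \ {0} := by
  ext x
  simp only [mem_sdiff, mem_preimage, mem_Ici, mem_singleton_iff]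
  exact and_congr_left fun hx => le_schwarzFun_iff hn hf hfin hx hc

theorem measurable_schwarzFun (hn : 1 ≤ n) {f : EuclideanSpace ℝ (Fin n) → ℝ}
    (hf : Measurable f) (hfin : ∀ c, 0 < c → volume {y | c ≤ |f y|} ≠ ∞) :
    Measurable (schwarzFun f) := by
  refine measurable_of_Ici fun c => ?_
  rcases le_or_gt c 0 with hc | hc
  · have : schwarzFun f ⁻¹' Ici c = univ := by
      ext x; simpa using hc.trans (schwarzFun_nonneg f x)
    rw [this]; exact .univ
  · rw [← sdiff_union_inter (schwarzFun f ⁻¹' Ici c) {0},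
      schwarzFun_preimage_Ici_sdiff hn hf hfin hc]
    exact ((measurableSet_schwarzSet _).diff (measurableSet_singleton 0)).union
      (subsingleton_singleton.anti inter_subset_right).measurableSet

theorem isSymmDecreasingRearr_schwarzFun (hn : 1 ≤ n) {f : EuclideanSpace ℝ (Fin n) → ℝ}
    (hf : Measurable f) (hf0 : ∀ x, 0 ≤ f x) (hfin : ∀ c, 0 < c → volume {y | c ≤ |f y|} ≠ ∞) :
    IsSymmDecreasingRearr f (schwarzFun f) := by
  intro c hc
  have : Nonempty (Fin n) := ⟨⟨0, hn⟩⟩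
  have hlev : f ⁻¹' Ici c = {y | c ≤ |f y|} := by
    ext y; simp [abs_of_nonneg (hf0 y)]
  have hae : schwarzFun f ⁻¹' Ici c =ᵐ[volume] schwarzSet {y | c ≤ |f y|} := by
    have h0 : volume ({0} : Set (EuclideanSpace ℝ (Fin n))) = 0 := measure_singleton 0
    refine (sdiff_null_ae_eq_self h0).symm.trans ?_
    rw [schwarzFun_preimage_Ici_sdiff hn hf hfin hc]
    exact sdiff_null_ae_eq_self h0
  rw [hlev]
  by_cases h0 : volume {y | c ≤ |f y|} = 0
  · refine ⟨0, by simp [h0], hae.trans ?_⟩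
    simp [schwarzSet, h0]
  · obtain ⟨r, hr, hr1, hr2⟩ := exists_schwarzSet_eq_closedBall hn h0 (hfin c hc)
    have hcb := Measure.addHaar_closedBall_eq_addHaar_ball volume
      (0 : EuclideanSpace ℝ (Fin n)) r
    refine ⟨r, hr2.trans hcb, hae.trans ?_⟩
    rw [hr1]
    exact (ae_eq_of_subset_of_measure_ge Metric.ball_subset_closedBall hcb.le
      Metric.isOpen_ball.measurableSet.nullMeasurableSet measure_closedBall_lt_top.ne).symm

theorem schwarzFun_congr_ae {f g : EuclideanSpace ℝ (Fin n) → ℝ} (h : f =ᵐ[volume] g) :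
    schwarzFun f = schwarzFun g := by
  have hlev : ∀ t : ℝ, volume {y | t ≤ |f y|} = volume {y | t ≤ |g y|} := fun t =>
    measure_congr (h.mono fun y hy => by
      change (t ≤ |f y|) = (t ≤ |g y|)
      rw [hy])
  have hset : ∀ t : ℝ, schwarzSet {y | t ≤ |f y|} = schwarzSet {y | t ≤ |g y|} := fun t => by
    simp only [schwarzSet, hlev]
  funext x
  simp only [schwarzFun, hset]

theorem schwarzFun_abs (f : EuclideanSpace ℝ (Fin n) → ℝ) :
    schwarzFun (fun x => |f x|) = schwarzFun f := by
  funext x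
  simp only [schwarzFun, abs_abs]

/-- The gauge of a star body is the inverse of its radial function. Positivity of the radial
function excludes the junk value `sSup = 0` of an empty or unbounded set. -/
theorem IsStarBody.gauge_lt_iff {K : Set (EuclideanSpace ℝ (Fin n))} (hK : IsStarBody K) {t : ℝ}
    (ht : 0 < t) {x : EuclideanSpace ℝ (Fin n)} (hx : x ≠ 0) :
    gauge K x < t ↔ t⁻¹ < radialFun K x := by
  have hρ := hK.radial_pos x hx
  set S := {r : ℝ | 0 ≤ r ∧ r • x ∈ K} with hS
  have hbdd : BddAbove S := by
    by_contra h
    rw [radialFun, Real.sSup_of_not_bddAbove h] at hρ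
    exact hρ.false
  have hne : S.Nonempty := by
    by_contra h
    rw [radialFun, ← hS, not_nonempty_iff_eq_empty.1 h, Real.sSup_empty] at hρ
    exact hρ.false
  have hSpos : ∃ r ∈ S, 0 < r := exists_lt_of_lt_csSup hne hρ
  have hG : ∀ {r}, 0 < r → (r ∈ S ↔ r⁻¹ ∈ {r ∈ Ioi (0 : ℝ) | r⁻¹ • x ∈ K}) := fun hr => by
    simp [hS, hr, hr.le]
  rw [gauge_def', csInf_lt_iff ⟨0, fun r hr => le_of_lt hr.1⟩, radialFun, lt_csSup_iff hbdd hne]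
  · constructor
    · rintro ⟨r, hr, hrt⟩
      have hr0 : 0 < r := hr.1
      exact ⟨r⁻¹, (hG (inv_pos.2 hr0)).2 (by rwa [inv_inv]), (inv_lt_inv₀ ht hr0).2 hrt⟩
    · rintro ⟨r, hr, hrt⟩
      have hr0 : 0 < r := (inv_pos.2 ht).trans hrt
      exact ⟨r⁻¹, (hG hr0).1 hr, inv_lt_of_inv_lt₀ ht hrt⟩
  · obtain ⟨r, hr, hr0⟩ := hSpos
    exact ⟨r⁻¹, (hG hr0).1 hr⟩

theorem IsStarBody.gaugeBall_sdiff_eq {K : Set (EuclideanSpace ℝ (Fin n))} (hK : IsStarBody K)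
    {t : ℝ} (ht : 0 < t) :
    {x | gauge K x < t} \ {0} = {0}ᶜ ∩ radialFun K ⁻¹' Ioi t⁻¹ := by
  ext x
  simp only [mem_sdiff, mem_ofPred_eq, mem_singleton_iff, mem_inter_iff, mem_compl_iff,
    mem_preimage, mem_Ioi]
  constructor
  · rintro ⟨h, hx⟩; exact ⟨hx, (hK.gauge_lt_iff ht hx).1 h⟩
  · rintro ⟨hx, h⟩; exact ⟨(hK.gauge_lt_iff ht hx).2 h, hx⟩

theorem IsStarBody.isOpen_gaugeBall_sdiff {K : Set (EuclideanSpace ℝ (Fin n))}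
    (hK : IsStarBody K) {t : ℝ} (ht : 0 < t) : IsOpen ({x | gauge K x < t} \ {0}) := by
  rw [hK.gaugeBall_sdiff_eq ht]
  exact hK.radial_continuousOn.isOpen_inter_preimage isOpen_compl_singleton isOpen_Ioi

theorem IsStarBody.measurableSet_gaugeBall {K : Set (EuclideanSpace ℝ (Fin n))}
    (hK : IsStarBody K) {t : ℝ} (ht : 0 < t) : MeasurableSet {x | gauge K x < t} := by
  rw [← sdiff_union_inter {x | gauge K x < t} {0}]
  exact (hK.isOpen_gaugeBall_sdiff ht).measurableSet.union
    (subsingleton_singleton.anti inter_subset_right).measurableSet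

theorem IsStarBody.isBounded_gaugeBall {K : Set (EuclideanSpace ℝ (Fin n))} (hK : IsStarBody K)
    {t : ℝ} (ht : 0 < t) : Bornology.IsBounded {x | gauge K x < t} := by
  obtain ⟨M, hM⟩ := (isCompact_sphere (0 : EuclideanSpace ℝ (Fin n)) 1).bddAbove_image
    (hK.radial_continuousOn.mono fun x hx => by
      rintro rfl
      simp at hx)
  refine (Metric.isBounded_closedBall (x := (0 : EuclideanSpace ℝ (Fin n))) (r := t * |M|)).subset
    fun x hx => ?_
  rw [mem_closedBall_zero_iff]
  by_cases hx0 : x = 0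
  · rw [hx0, norm_zero]; positivity
  have hnx : 0 < ‖x‖ := norm_pos_iff.2 hx0
  have hxy : x = ‖x‖ • (‖x‖⁻¹ • x) := by rw [smul_smul, mul_inv_cancel₀ hnx.ne', one_smul]
  set y := ‖x‖⁻¹ • x with hy
  have hy1 : ‖y‖ = 1 := by rw [hy, norm_smul, norm_inv, norm_norm, inv_mul_cancel₀ hnx.ne']
  have hy0 : y ≠ 0 := norm_pos_iff.1 (by rw [hy1]; exact one_pos)
  have hgy : gauge K y < t / ‖x‖ := by
    have h1 : gauge K x < t := hx
    rw [hxy, gauge_smul_of_nonneg (norm_nonneg x), smul_eq_mul] at h1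
    rwa [lt_div_iff₀' hnx]
  have h2 := (hK.gauge_lt_iff (by positivity) hy0).1 hgy
  have h3 : radialFun K y ≤ M := hM ⟨y, by simpa using hy1, rfl⟩
  rw [inv_div] at h2
  have h4 := (h2.trans_le (h3.trans (le_abs_self M))).le
  rwa [div_le_iff₀' ht] at h4

/-- A star body and its open gauge ball have the same measure: `{‖x‖_K < t} ⊆ t K ⊆ {‖x‖_K < r t}`
up to the origin for every `r > 1`. In particular `K` need not be assumed measurable. -/
theorem IsStarBody.volume_gaugeBall (hn : 1 ≤ n) {K : Set (EuclideanSpace ℝ (Fin n))}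
    (hK : IsStarBody K) {t : ℝ} (ht : 0 < t) :
    volume {x | gauge K x < t} = ENNReal.ofReal (t ^ n) * volume K := by
  have : Nonempty (Fin n) := ⟨⟨0, hn⟩⟩
  have hsmul : ∀ {r : ℝ}, 0 < r → ∀ S : Set (EuclideanSpace ℝ (Fin n)),
      volume (r • S) = ENNReal.ofReal (r ^ n) * volume S := fun {r} hr S => by
    rw [Measure.addHaar_smul, finrank_euclideanSpace_fin, abs_of_pos (by positivity)]
  refine le_antisymm ?_ ?_
  · rw [← hsmul ht, ← measure_sdiff_null (s := {x | gauge K x < t}) (measure_singleton 0)]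
    refine measure_mono ?_
    rintro x ⟨hx, hx0⟩
    have h1 := (hK.gauge_lt_iff ht hx0).1 hx
    obtain ⟨r, ⟨hr0, hr⟩, htr⟩ := exists_lt_of_lt_csSup (s := {r : ℝ | 0 ≤ r ∧ r • x ∈ K}) (by
      by_contra h
      have hρ := hK.radial_pos x hx0
      rw [radialFun, not_nonempty_iff_eq_empty.1 h, Real.sSup_empty] at hρ
      exact hρ.false) h1
    rw [mem_smul_set_iff_inv_smul_mem₀ ht.ne']
    have hrpos : 0 < r := (inv_pos.2 ht).trans htr
    have := hK.starConvex.smul_mem hr (t := t⁻¹ / r) (by positivity)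
      ((div_le_one hrpos).2 htr.le)
    rwa [smul_smul, div_mul_cancel₀ _ hrpos.ne'] at this
  · have hε : ∀ r : ℝ, 1 < r →
        ENNReal.ofReal (t ^ n) * volume K ≤
          ENNReal.ofReal (r ^ n) * volume {x | gauge K x < t} := by
      intro r hr
      have hr0 : 0 < r := by linarith
      rw [← hsmul ht, ← hsmul hr0]
      refine measure_mono fun x hx => ?_
      rw [mem_smul_set_iff_inv_smul_mem₀ hr0.ne', mem_ofPred_eq,
        gauge_smul_of_nonneg (inv_nonneg.2 hr0.le), smul_eq_mul]
      have h1 : gauge K x ≤ t := gauge_le_of_mem ht.le hx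
      have h2 : r⁻¹ < 1 := inv_lt_one_of_one_lt₀ hr
      have h3 : 0 < r⁻¹ := by positivity
      nlinarith
    have hlim : Filter.Tendsto (fun r : ℝ => ENNReal.ofReal (r ^ n) * volume {x | gauge K x < t})
        (nhdsWithin 1 (Ioi 1)) (nhds (ENNReal.ofReal (1 ^ n) * volume {x | gauge K x < t})) := by
      refine ENNReal.Tendsto.mul_const ?_ (Or.inr (hK.isBounded_gaugeBall ht).measure_lt_top.ne)
      have hc : Continuous fun r : ℝ => ENNReal.ofReal (r ^ n) :=
        ENNReal.continuous_ofReal.comp (continuous_pow n)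
      exact (hc.tendsto 1).mono_left nhdsWithin_le_nhds
    rw [one_pow, ENNReal.ofReal_one, one_mul] at hlim
    exact ge_of_tendsto hlim (eventually_nhdsWithin_of_forall hε)

theorem IsStarBody.volume_ne_zero (hn : 1 ≤ n) {K : Set (EuclideanSpace ℝ (Fin n))}
    (hK : IsStarBody K) : volume K ≠ 0 := by
  have : Nonempty (Fin n) := ⟨⟨0, hn⟩⟩
  obtain ⟨x, hx⟩ := exists_ne (0 : EuclideanSpace ℝ (Fin n))
  have hg : 0 ≤ gauge K x := gauge_nonneg x
  have ht : 0 < gauge K x + 1 := by linarith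
  have hpos : 0 < volume ({y | gauge K y < gauge K x + 1} \ {0}) :=
    (hK.isOpen_gaugeBall_sdiff ht).measure_pos volume ⟨x, by simp, hx⟩
  have h2 := hpos.trans_le (measure_mono sdiff_subset)
  rw [hK.volume_gaugeBall hn ht] at h2
  exact (pos_of_mul_pos_right h2 (zero_le)).ne'

theorem IsStarBody.volume_ne_top (hn : 1 ≤ n) {K : Set (EuclideanSpace ℝ (Fin n))}
    (hK : IsStarBody K) : volume K ≠ ∞ := by
  have h := hK.volume_gaugeBall hn one_pos
  rw [one_pow, ENNReal.ofReal_one, one_mul] at h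
  rw [← h]
  exact (hK.isBounded_gaugeBall one_pos).measure_lt_top.ne

theorem eLpNorm_ofReal_rpow {p : ℝ} (hp : 1 ≤ p) (F : EuclideanSpace ℝ (Fin n) → ℝ) :
    eLpNorm F (ENNReal.ofReal p) volume ^ p = ∫⁻ x, ENNReal.ofReal (|F x| ^ p) := by
  have hp0 : 0 < p := by linarith
  rw [eLpNorm_eq_lintegral_rpow_enorm_toReal (by simpa using hp0) ENNReal.ofReal_ne_top,
    ENNReal.toReal_ofReal hp0.le, ← ENNReal.rpow_mul, one_div_mul_cancel hp0.ne', ENNReal.rpow_one]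
  refine lintegral_congr fun x => ?_
  rw [← ENNReal.ofReal_rpow_of_nonneg (abs_nonneg _) hp0.le, Real.enorm_eq_ofReal_abs]

end AnisotropicModulus

end

theorem proposition3p6 (n : ℕ) (hn : 1 ≤ n) (p : ℝ) (hp : 1 ≤ p)
    (K : Set (EuclideanSpace ℝ (Fin n))) (hK : AnisotropicModulus.IsStarBody K)
    (f : EuclideanSpace ℝ (Fin n) → ℝ) (hf : MemLp f (ENNReal.ofReal p) volume)
    (t : ℝ) (ht : 0 < t) :
    AnisotropicModulus.modulus (AnisotropicModulus.schwarzSet K)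
        (AnisotropicModulus.schwarzFun f) t p
      ≤ AnisotropicModulus.modulus K f t p := by
  open AnisotropicModulus in
  have hp0 : 0 < p := by linarith
  have : Nonempty (Fin n) := ⟨⟨0, hn⟩⟩
  have hKt := hK.volume_ne_top hn
  obtain ⟨r, hr, hr1, hr2⟩ := exists_schwarzSet_eq_closedBall hn (hK.volume_ne_zero hn) hKt
  have hball : {h | gauge (schwarzSet K) h < t} = Metric.ball 0 (t * r) := by
    ext h
    rw [hr1, Set.mem_ofPred_eq, gauge_closedBall hr.le, mem_ball_zero_iff, div_lt_iff₀ hr]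
  have hvol : volume {h | gauge K h < t} =
      volume (Metric.ball (0 : EuclideanSpace ℝ (Fin n)) (t * r)) := by
    rw [hK.volume_gaugeBall hn ht, hr2, Measure.addHaar_ball_mul_of_pos volume _ ht,
      finrank_euclideanSpace_fin, Measure.addHaar_closedBall_eq_addHaar_ball]
  obtain ⟨f₀, hf₀, hff₀⟩ := hf.aestronglyMeasurable.aemeasurable
  set g : EuclideanSpace ℝ (Fin n) → ℝ := fun x => |f₀ x| with hg
  have hgm : Measurable g := hf₀.abs
  have hg0 : ∀ x, 0 ≤ g x := fun x => abs_nonneg _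
  have hfin : ∀ c, 0 < c → volume {y | c ≤ |g y|} ≠ ⊤ := by
    intro c hc
    have h := ((memLp_congr_ae hff₀).1 hf).meas_ge_lt_top (ε := c.toNNReal)
      (by simpa using hp0) ENNReal.ofReal_ne_top (by simpa using hc)
    refine (lt_of_le_of_lt (measure_mono fun y hy => ?_) h).ne
    simp only [hg, abs_abs, Set.mem_ofPred_eq] at hy ⊢
    rw [← NNReal.coe_le_coe, Real.coe_toNNReal _ hc.le, coe_nnnorm]
    exact hy
  have hsch : schwarzFun f = schwarzFun g := by
    rw [hg, schwarzFun_abs, schwarzFun_congr_ae hff₀]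
  have hmain := (isSymmDecreasingRearr_schwarzFun hn hgm hg0 hfin).lintegral_abs_sub_le hgm
    (measurable_schwarzFun hn hgm hfin) (schwarzFun_nonneg g) (hK.measurableSet_gaugeBall ht)
    hvol hp
  rw [modulus, modulus, volume_schwarzSet hn K hKt, hball, hsch]
  simp only [eLpNorm_ofReal_rpow hp]
  refine ENNReal.rpow_le_rpow (mul_le_mul_right (hmain.trans ?_) _) (by positivity)
  refine lintegral_mono fun h => ?_
  refine lintegral_mono_ae ?_
  have hshift : (fun x => f (x + h)) =ᵐ[volume] fun x => f₀ (x + h) :=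
    (measurePreserving_add_right volume h).quasiMeasurePreserving.ae_eq_comp hff₀
  filter_upwards [hff₀, hshift] with x hx hxh
  rw [hx, hxh]
  exact ENNReal.ofReal_le_ofReal
    (Real.rpow_le_rpow (abs_nonneg _) (abs_abs_sub_abs_le_abs_sub _ _) hp0.le)
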